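/- Let $M$ be a $C^\infty$-manifold in the sense of convenient calculus, i.e. a set with a smooth atlas whose charts are bijections from subsets of $M$ onto $c^\infty$-open subsets of convenient vector spaces; it is endowed with the diffeology of all smooth parametrizations and with the corresponding $D$-topology (the final topology for the plots), and it is assumed to be separated as an arc-generated space: $\{t\in\mathbb R \mid a(t)=b(t)\}$ is closed for all continuous curves $a,b:\mathbb R\to M$. (This includes all Hausdorff finite-dimensional smooth manifolds.) Let $\dim M\in\mathbb N\cup\{\infty\}$ be the supremum of the dimensions of the modelling vector spaces at the points of $M$, let $d$ be an integer with $0<d<\dim M$, and let $M_d$ be the set $M$ with the $d$-skeletal diffeology, i.e. the diffeology generated by the plots of $M$ of dimension $\le d$. Then: 1. $M_d$ is not locally contractible as a diffeological space, even in the weak sense: it is not true that for every $x\in M_d$ and every $D$-open $U\ni x$ there is a $D$-open $V$ with $x\in V\subseteq U$ such that the inclusion $V\hookrightarrow U$ is smoothly homotopic to a constant map, where $V$ and $U$ carry the subspace diffeologies of $M_d$ and a smooth homotopy is a smooth map $V\times\mathbb R\to U$ restricting to the two given maps at times $0$ and $1$. In particular, the smoothly contractible $D$-open subsets of $M_d$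 do not form a basis of its $D$-topology. 2. The underlying topological space of $M_d$ (the set $M$ with the $D$-topology of $M_d$) is locally contractible, in the strong sense that its contractible open subsets form a basis of its topology. -/

import Mathlib

open Set Filter Topology Diffeology
open scoped ContDiff

namespace Skeletal

/-! ### Convenient calculus -/

section Convenient

universe u v

variable {E : Type u} {F : Type v} [AddCommGroup E] [Module ℝ E] [TopologicalSpace E]
  [AddCommGroup F] [Module ℝ F] [TopologicalSpace F]

/-- `c'` is the derivative of the curve `c`: everywhere it is the limit of the difference
quotients of `c`. -/
def HasCurveDeriv (c c' : ℝ → E) : Prop :=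
  ∀ t : ℝ, Tendsto (fun h : ℝ ↦ h⁻¹ • (c (t + h) - c t)) (𝓝[≠] 0) (𝓝 (c' t))

/-- A curve is smooth if all its iterated derivatives exist. -/
def IsSmoothCurve (c : ℝ → E) : Prop :=
  ∃ D : ℕ → ℝ → E, D 0 = c ∧ ∀ k, HasCurveDeriv (D k) (D (k + 1))

/-- The open sets of the `c^∞`-topology, the final topology for the smooth curves. -/
def IsCInftyOpen (U : Set E) : Prop :=
  ∀ c : ℝ → E, IsSmoothCurve c → IsOpen (c ⁻¹' U)

/-- A map between (`c^∞`-open subsets of) locally convex spaces is smooth if it sends smooth curves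
to smooth curves. -/
def ConvSmoothOn (f : E → F) (U : Set E) : Prop :=
  ∀ c : ℝ → E, IsSmoothCurve c → (∀ t, c t ∈ U) → IsSmoothCurve (f ∘ c)

/-- A convenient vector space: a Hausdorff locally convex real vector space that is
`c^∞`-complete, i.e. in which every smooth curve has an antiderivative. -/
class ConvenientSpace (E : Type u) [AddCommGroup E] [Module ℝ E] [TopologicalSpace E] : Prop where
  isTopologicalAddGroup : IsTopologicalAddGroup E
  continuousSMul : ContinuousSMul ℝ E
  locallyConvex : LocallyConvexSpace ℝ E
  t2 : T2Space E
  exists_antideriv : ∀ c : ℝ → E, IsSmoothCurve c → ∃ C : ℝ → E, HasCurveDeriv C c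

theorem hasCurveDeriv_iff {G : Type*} [NormedAddCommGroup G] [NormedSpace ℝ G] {c c' : ℝ → G} :
    HasCurveDeriv c c' ↔ ∀ t, HasDerivAt c (c' t) t := by
  simp [HasCurveDeriv, hasDerivAt_iff_tendsto_slope_zero]

/-- In a normed space, smooth curves are the usual ones. -/
theorem isSmoothCurve_iff_contDiff {G : Type*} [NormedAddCommGroup G] [NormedSpace ℝ G]
    {c : ℝ → G} : IsSmoothCurve c ↔ ContDiff ℝ ∞ c := by
  constructor
  · rintro ⟨D, rfl, hD⟩
    have h : ∀ k, iteratedDeriv k (D 0) = D k := by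
      intro k
      induction k with
      | zero => simp
      | succ k ih =>
        rw [iteratedDeriv_succ, ih]
        exact funext fun t ↦ (hasCurveDeriv_iff.1 (hD k) t).deriv
    refine contDiff_of_differentiable_iteratedDeriv fun m _ ↦ ?_
    rw [h m]
    exact fun t ↦ (hasCurveDeriv_iff.1 (hD m) t).differentiableAt
  · intro hc
    refine ⟨fun k ↦ iteratedDeriv k c, by simp, fun k ↦ hasCurveDeriv_iff.2 fun t ↦ ?_⟩
    simp only [iteratedDeriv_succ]
    exact ((hc.differentiable_iteratedDeriv k (by exact_mod_cast ENat.natCast_lt_top k)) t).hasDerivAt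

theorem isSmoothCurve_const (x : E) : IsSmoothCurve (fun _ : ℝ ↦ x) := by
  refine ⟨fun k _ ↦ if k = 0 then x else 0, by simp, fun k t ↦ ?_⟩
  simpa using tendsto_const_nhds

end Convenient

/-! ### `C^∞`-manifolds modelled on convenient vector spaces -/

/-- A `C^∞`-atlas on the set `M`: charts are bijections from subsets of `M` onto `c^∞`-open
subsets of convenient vector spaces `E i` (which may vary with the chart), they cover `M`, and the
chart changings are smooth and defined on `c^∞`-open sets. -/
structure ConvAtlas (M : Type*) {ι : Type*} (E : ι → Type*) [∀ i, AddCommGroup (E i)]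
    [∀ i, Module ℝ (E i)] [∀ i, TopologicalSpace (E i)] where
  chart : ∀ i, PartialEquiv M (E i)
  cover : ∀ x, ∃ i, x ∈ (chart i).source
  isCInftyOpen_target : ∀ i, IsCInftyOpen (chart i).target
  isCInftyOpen_overlap : ∀ i j, IsCInftyOpen ((chart i).symm.trans (chart j)).source
  smooth_overlap : ∀ i j,
    ConvSmoothOn ((chart i).symm.trans (chart j)) ((chart i).symm.trans (chart j)).source

namespace ConvAtlas

variable {M : Type*} {ι : Type*} {E : ι → Type*} [∀ i, AddCommGroup (E i)]
  [∀ i, Module ℝ (E i)] [∀ i, TopologicalSpace (E i)]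

/-- The dimension of a manifold, in `ℕ∞`: the supremum, over the points of the manifold and the
charts at these points, of the dimensions of the modelling vector spaces. -/
noncomputable def dim (A : ConvAtlas M E) : ℕ∞ :=
  ⨆ (i : ι) (_ : (A.chart i).source.Nonempty), Cardinal.toENat (Module.rank ℝ (E i))

/-- A parametrization `p` of `M` is smooth on the open set `u ⊆ ℝⁿ`: near every point of `u`, it
is a smooth map in every chart around the image point. -/
def SmoothParamOn (A : ConvAtlas M E) {n : ℕ} (u : Set (EuclideanSpace ℝ (Fin n)))
    (p : EuclideanSpace ℝ (Fin n) → M) : Prop :=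
  ∀ x ∈ u, ∀ i, p x ∈ (A.chart i).source → ∃ W ⊆ u, IsOpen W ∧ x ∈ W ∧
    MapsTo p W (A.chart i).source ∧ ConvSmoothOn (A.chart i ∘ p) W

/-- The standard diffeology of a `C^∞`-manifold; its plots are the smooth parametrizations. -/
@[reducible]
noncomputable def diffeology (A : ConvAtlas M E) : DiffeologicalSpace M :=
  DiffeologicalSpace.ofCorePlotsOn
    { isPlotOn := fun {_ u} _ p ↦ A.SmoothParamOn u p
      isPlotOn_congr := by
        intro n u hu p q h
        have key : ∀ {n : ℕ} {u : Set (EuclideanSpace ℝ (Fin n))}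
            {p q : EuclideanSpace ℝ (Fin n) → M}, EqOn p q u → A.SmoothParamOn u p →
            A.SmoothParamOn u q := by
          intro n u p q h hp x hx i hi
          obtain ⟨W, hWu, hW, hxW, hm, hs⟩ := hp x hx i (by rwa [h hx])
          refine ⟨W, hWu, hW, hxW, hm.congr (h.mono hWu), fun c hc hcW ↦ ?_⟩
          convert! hs c hc hcW using 1
          funext t
          simp [h (hWu (hcW t))]
        exact ⟨key h, key h.symm⟩
      isPlot_const := by
        intro n x y _ i hi
        exact ⟨univ, subset_rfl, isOpen_univ, mem_univ _, fun _ _ ↦ hi,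
          fun c _ _ ↦ isSmoothCurve_const _⟩
      isPlotOn_reparam := by
        intro n m u v hu hv p f h hp hf x hx i hi
        obtain ⟨W, hWu, hW, hxW, hm, hs⟩ := hp (f x) (h hx) i hi
        refine ⟨v ∩ f ⁻¹' W, inter_subset_left, hf.continuousOn.isOpen_inter_preimage hv hW,
          ⟨hx, hxW⟩, fun y hy ↦ hm hy.2, fun c hc hcW ↦ hs (f ∘ c) ?_ fun t ↦ (hcW t).2⟩
        rw [isSmoothCurve_iff_contDiff] at hc ⊢
        exact hf.comp_contDiff hc fun t ↦ (hcW t).1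
      locality := by
        intro n u hu p hp x hx i hi
        obtain ⟨v, _, hxv, hpv⟩ := hp x hx
        obtain ⟨W, _, hW, hxW, hm, hs⟩ := hpv x hxv i hi
        exact ⟨W ∩ u, inter_subset_right, hW.inter hu, ⟨hxW, hx⟩, fun y hy ↦ hm hy.1,
          fun c hc hcW ↦ hs c hc fun t ↦ (hcW t).1⟩ }

end ConvAtlas

/-! ### Diffeological notions -/

/-- The `d`-skeletal diffeology: the one generated by the plots of dimension at most `d`. -/
@[reducible]
def skeleton {X : Type*} (d : ℕ) (D : DiffeologicalSpace X) : DiffeologicalSpace X :=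
  DiffeologicalSpace.generateFrom {p | p.1 ≤ d ∧ @IsPlot X D p.1 p.2}

/-- The initial diffeology for a map `f : X → Y`. -/
@[reducible]
def initialDiffeology {X Y : Type*} (f : X → Y) (D : DiffeologicalSpace Y) :
    DiffeologicalSpace X where
  plots n := {p | @IsPlot Y D n (f ∘ p)}
  constant_plots x := D.constant_plots (f x)
  plot_reparam hp hf := D.plot_reparam hp hf
  locality h := D.locality h

/-- The subspace diffeology. -/
@[reducible]
def subspaceDiffeology {X : Type*} (D : DiffeologicalSpace X) (S : Set X) : DiffeologicalSpace S :=
  initialDiffeology Subtype.val D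

/-- The product diffeology. -/
@[reducible]
def prodDiffeology {X Y : Type*} (D : DiffeologicalSpace X) (D' : DiffeologicalSpace Y) :
    DiffeologicalSpace (X × Y) :=
  initialDiffeology Prod.fst D ⊓ initialDiffeology Prod.snd D'

/-- Two maps between diffeological spaces are smoothly homotopic if some smooth map
`H : X × ℝ → Y` restricts to them at times `0` and `1`. -/
def SmoothlyHomotopic {X Y : Type*} (D : DiffeologicalSpace X) (D' : DiffeologicalSpace Y)
    (f g : X → Y) : Prop :=
  ∃ H : X × ℝ → Y, @DSmooth (X × ℝ) Y (prodDiffeology D inferInstance) D' H ∧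
    (∀ x, H (x, 0) = f x) ∧ ∀ x, H (x, 1) = g x

/-- Local contractibility of a diffeological space, in its weak (classical) form: every
`D`-open neighbourhood `U` of every point contains a `D`-open neighbourhood `V` of that point whose
inclusion into `U` is smoothly homotopic to a constant map. Every diffeological space in which
smoothly contractible `D`-open sets form a basis has this property. -/
def SmoothlyLocallyContractible {X : Type*} (D : DiffeologicalSpace X) : Prop :=
  ∀ (x : X) (U : Set X), IsOpen[D.dTopology] U → x ∈ U →
    ∃ (V : Set X) (hVU : V ⊆ U), IsOpen[D.dTopology] V ∧ x ∈ V ∧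
      ∃ y : U, SmoothlyHomotopic (subspaceDiffeology D V) (subspaceDiffeology D U)
        (inclusion hVU) (fun _ ↦ y)

/-- Local contractibility of a topological space, in its strong form: the contractible open sets
form a basis. This implies `LocallyContractibleSpace` and `StronglyLocallyContractibleSpace`. -/
def HasContractibleOpenBasis (X : Type*) [TopologicalSpace X] : Prop :=
  ∀ (x : X) (U : Set X), IsOpen U → x ∈ U →
    ∃ V ⊆ U, IsOpen V ∧ x ∈ V ∧ ContractibleSpace V

/-- Separatedness as an arc-generated space: the diagonal is closed in the arc-generated product
`X × X`, whose topology is final for the continuous curves `t ↦ (a t, b t)`. -/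
def ArcSeparated (X : Type*) [TopologicalSpace X] : Prop :=
  ∀ a b : ℝ → X, Continuous a → Continuous b → IsClosed {t | a t = b t}

end Skeletal

open Skeletal

namespace Skeletal

/-! ### Smooth curves in topological vector spaces -/

section Curves

variable {E F : Type*} [AddCommGroup E] [Module ℝ E] [TopologicalSpace E]
  [AddCommGroup F] [Module ℝ F] [TopologicalSpace F]

/-! Failure of smooth contractibility. A smooth homotopy in `M_d` sends plots to plots of `M_d`, and
these factor locally through `ℝᵏ` with `k ≤ d`. Choose a chart whose model space splits off `ℝᵈ⁺¹`,
take a small `d`-sphere in it, and suppose that the inclusion of a neighbourhood into the chart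
domain contracts. The contraction, with the radius controlling time, fills the sphere by a map of
the ball; projected to `ℝᵈ⁺¹` this is a map `G` that is the identity on the unit sphere and factors
locally through `ℝᵏ`, `k ≤ d`. The sphere itself, parametrized radially, factors locally through
`ℝᵈ`, so it is seen by `M_d`.

The second factor of `G` is smooth only in the convenient sense; the special curve lemma makes it
locally Lipschitz (`ConvSmoothOn.exists_lipschitzOnWith`). That is enough: `G` is locally Lipschitz
and `det DG = 0` wherever `G` is differentiable (`det_fderiv_eq_zero_of_factor`). This contradicts
`exists_det_fderiv_ne_zero`, a no-retraction theorem proved by Milnor's volume argument. With `g = G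
- id` cut off outside the ball, `id + t g` is a bijection of the ball for small `t ≥ 0`, so `∫ det
(1 + t Dg)` is the volume of the ball for these `t`. The integral is polynomial in `t`, hence has
the same value at `t = 1`, where the integrand vanishes.

Topological contractibility. Openness in `M` is tested by smooth curves in charts. As `d ≥ 1`, these
curves are plots of `M_d`, so the two `D`-topologies agree. In a chart, the star-shaped core of a
`c^∞`-open set is `c^∞`-open, and it contracts along segments. -/

theorem IsSmoothCurve.exists_deriv {c : ℝ → E} (hc : IsSmoothCurve c) :
    ∃ c', HasCurveDeriv c c' ∧ IsSmoothCurve c' := by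
  obtain ⟨D, rfl, hD⟩ := hc
  exact ⟨D 1, hD 0, fun k ↦ D (k + 1), rfl, fun k ↦ hD (k + 1)⟩

/-- Coinduction principle for smoothness of curves. -/
theorem isSmoothCurve_of_forall_exists (S : Set (ℝ → E))
    (hS : ∀ c ∈ S, ∃ c' ∈ S, HasCurveDeriv c c') {c : ℝ → E} (hc : c ∈ S) : IsSmoothCurve c := by
  choose! f hfS hf using hS
  have h : ∀ k, f^[k] c ∈ S := fun k ↦ by
    induction k with
    | zero => exact hc
    | succ k ih => rw [Function.iterate_succ_apply']; exact hfS _ ih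
  refine ⟨fun k ↦ f^[k] c, rfl, fun k ↦ ?_⟩
  simp only [Function.iterate_succ_apply']
  exact hf _ (h k)

theorem HasCurveDeriv.clm_comp {c c' : ℝ → E} (h : HasCurveDeriv c c') (T : E →L[ℝ] F) :
    HasCurveDeriv (T ∘ c) (T ∘ c') := by
  intro t
  refine ((T.continuous.tendsto _).comp (h t)).congr fun s ↦ ?_
  simp

theorem IsSmoothCurve.clm_comp {c : ℝ → E} (h : IsSmoothCurve c) (T : E →L[ℝ] F) :
    IsSmoothCurve (T ∘ c) := by
  obtain ⟨D, rfl, hD⟩ := h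
  exact ⟨fun k ↦ T ∘ D k, rfl, fun k ↦ (hD k).clm_comp T⟩

theorem HasCurveDeriv.add [IsTopologicalAddGroup E] {a a' b b' : ℝ → E} (ha : HasCurveDeriv a a')
    (hb : HasCurveDeriv b b') : HasCurveDeriv (a + b) (a' + b') := by
  intro t
  refine ((ha t).add (hb t)).congr fun s ↦ ?_
  simp only [Pi.add_apply, ← smul_add]
  congr 1
  abel

theorem IsSmoothCurve.add [IsTopologicalAddGroup E] {a b : ℝ → E} (ha : IsSmoothCurve a) (hb : IsSmoothCurve b) :
    IsSmoothCurve (a + b) := by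
  obtain ⟨D, rfl, hD⟩ := ha
  obtain ⟨D', rfl, hD'⟩ := hb
  exact ⟨fun k ↦ D k + D' k, rfl, fun k ↦ (hD k).add (hD' k)⟩

variable [ContinuousSMul ℝ E]

/-- The inner increment may vanish for `h ≠ 0`, so the outer difference quotient is first extended
continuously to increment `0` by the value of the derivative. -/
theorem HasCurveDeriv.comp {c c' : ℝ → E} (hc : HasCurveDeriv c c') {γ γ' : ℝ → ℝ}
    (hγ : HasCurveDeriv γ γ') : HasCurveDeriv (c ∘ γ) (fun t ↦ γ' t • c' (γ t)) := by
  intro t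
  have hcont : ContinuousAt γ t := (hasCurveDeriv_iff.1 hγ t).continuousAt
  have h1 : Tendsto (Function.update (fun k : ℝ ↦ k⁻¹ • (c (γ t + k) - c (γ t))) 0 (c' (γ t)))
      (𝓝 0) (𝓝 (c' (γ t))) := by
    have := continuousAt_update_same (f := fun k : ℝ ↦ k⁻¹ • (c (γ t + k) - c (γ t)))
      (x := (0 : ℝ)) (y := c' (γ t))
    have h2 := this.2 (hc (γ t))
    simpa [ContinuousAt] using h2
  have h3 : Tendsto (fun h : ℝ ↦ γ (t + h) - γ t) (𝓝[≠] 0) (𝓝 0) := by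
    have : Tendsto (fun h : ℝ ↦ t + h) (𝓝 0) (𝓝 t) :=
      (continuous_const.add continuous_id).tendsto' _ _ (by simp)
    have := (hcont.tendsto.comp this).sub_const (γ t)
    simpa using this.mono_left nhdsWithin_le_nhds
  refine ((hγ t).smul (h1.comp h3)).congr fun h ↦ ?_
  by_cases hz : γ (t + h) - γ t = 0
  · rw [sub_eq_zero] at hz
    simp [hz]
  · simp only [Function.comp_apply, Function.update_of_ne hz, smul_eq_mul, add_sub_cancel]
    rw [mul_smul, smul_inv_smul₀ hz]

variable [IsTopologicalAddGroup E]

theorem HasCurveDeriv.smul {γ γ' : ℝ → ℝ} (hγ : HasCurveDeriv γ γ') {c c' : ℝ → E}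
    (hc : HasCurveDeriv c c') :
    HasCurveDeriv (fun t ↦ γ t • c t) (fun t ↦ γ' t • c t + γ t • c' t) := by
  intro t
  have hcont : ContinuousAt γ t := (hasCurveDeriv_iff.1 hγ t).continuousAt
  have h3 : Tendsto (fun h : ℝ ↦ γ (t + h)) (𝓝[≠] 0) (𝓝 (γ t)) := by
    have : Tendsto (fun h : ℝ ↦ t + h) (𝓝 0) (𝓝 t) :=
      (continuous_const.add continuous_id).tendsto' _ _ (by simp)
    exact (hcont.tendsto.comp this).mono_left nhdsWithin_le_nhds
  refine (((hγ t).smul_const (c t)).add (h3.smul (hc t))).congr fun h ↦ ?_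
  rw [smul_comm (γ (t + h)), smul_assoc, ← smul_add]
  congr 1
  module

/-- By the product and chain rules, the span of all curves `a • (b ∘ η)` with `a`, `b` smooth is
closed under differentiation; coinduction then applies. -/
theorem IsSmoothCurve.smul_comp {γ η : ℝ → ℝ} (hγ : ContDiff ℝ ∞ γ) (hη : ContDiff ℝ ∞ η)
    {c : ℝ → E} (hc : IsSmoothCurve c) : IsSmoothCurve (fun t ↦ γ t • c (η t)) := by
  let G : Set (ℝ → E) := {g | ∃ (a : ℝ → ℝ) (b : ℝ → E), ContDiff ℝ ∞ a ∧ IsSmoothCurve b ∧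
    g = fun t ↦ a t • b (η t)}
  refine isSmoothCurve_of_forall_exists (Submodule.span ℝ G : Set (ℝ → E)) (fun g hg ↦ ?_)
    (Submodule.subset_span ⟨γ, c, hγ, hc, rfl⟩)
  induction hg using Submodule.span_induction with
  | mem g hg =>
    obtain ⟨a, b, ha, hb, rfl⟩ := hg
    obtain ⟨a', ha', ha''⟩ := (isSmoothCurve_iff_contDiff.2 ha).exists_deriv
    obtain ⟨η', hη', hη''⟩ := (isSmoothCurve_iff_contDiff.2 hη).exists_deriv
    obtain ⟨b', hb', hb''⟩ := hb.exists_deriv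
    rw [isSmoothCurve_iff_contDiff] at ha'' hη''
    refine ⟨_, ?_, ha'.smul (hb'.comp hη')⟩
    refine Submodule.add_mem _ (Submodule.subset_span ⟨a', b, ha'', hb, rfl⟩)
      (Submodule.subset_span ⟨fun t ↦ a t * η' t, b', ha.mul hη'', hb'', ?_⟩)
    simp only [mul_smul]
  | zero => exact ⟨0, Submodule.zero_mem _, fun t ↦ by simpa using tendsto_const_nhds⟩
  | add x y _ _ hx hy =>
    obtain ⟨x', hx, hx'⟩ := hx
    obtain ⟨y', hy, hy'⟩ := hy
    exact ⟨x' + y', Submodule.add_mem _ hx hy, hx'.add hy'⟩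
  | smul r x _ hx =>
    obtain ⟨x', hx, hx'⟩ := hx
    refine ⟨r • x', Submodule.smul_mem _ r hx, fun t ↦ ((hx' t).const_smul r).congr fun h ↦ ?_⟩
    simp only [Pi.smul_apply, ← smul_sub]
    rw [smul_comm]

theorem IsSmoothCurve.comp {c : ℝ → E} (hc : IsSmoothCurve c) {η : ℝ → ℝ}
    (hη : ContDiff ℝ ∞ η) : IsSmoothCurve (c ∘ η) := by
  simpa [Function.comp_def] using hc.smul_comp (contDiff_const (c := (1 : ℝ))) hη

/-- Near any parameter in an open set, a curve can be reparametrized so that its parameters stay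
in that set. -/
theorem exists_reparam {O : Set ℝ} (hO : IsOpen O) {t : ℝ} (ht : t ∈ O) :
    ∃ η : ℝ → ℝ, ContDiff ℝ ∞ η ∧ (∀ s, η s ∈ O) ∧ η 0 = t ∧
      ∀ N ∈ 𝓝 (0 : ℝ), η '' N ∈ 𝓝 t := by
  obtain ⟨r, hr, hrO⟩ := Metric.isOpen_iff.1 hO t ht
  -- A diffeomorphism of the whole line onto a small interval around `t`.
  let e := OpenPartialHomeomorph.univBall t r
  have hsrc : e.source = univ := OpenPartialHomeomorph.univBall_source t r
  have h0 : e 0 = t := OpenPartialHomeomorph.univBall_apply_zero t r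
  refine ⟨e, OpenPartialHomeomorph.contDiff_univBall, fun s ↦ hrO ?_, h0, fun N hN ↦ ?_⟩
  · have := e.map_source (x := s) (by rw [hsrc]; trivial)
    rwa [OpenPartialHomeomorph.univBall_target t hr] at this
  · rw [← h0]
    exact e.image_mem_nhds (by rw [hsrc]; trivial) hN

end Curves

/-! ### The special curve lemma and its consequences -/

section SpecialCurve

theorem exists_bound_iteratedFDeriv {f : ℝ → ℝ} (hf : ContDiff ℝ ∞ f) (hs : HasCompactSupport f)
    (n : ℕ) : ∃ C : ℝ, 0 < C ∧ ∀ k ≤ n, ∀ t, ‖iteratedFDeriv ℝ k f t‖ ≤ C := by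
  have h : ∀ k : ℕ, ∃ C : ℝ, ∀ t, ‖iteratedFDeriv ℝ k f t‖ ≤ C := fun k ↦
    (hs.iteratedFDeriv (𝕜 := ℝ) k).exists_bound_of_continuous
      (hf.continuous_iteratedFDeriv (by exact_mod_cast le_top))
  choose C hC using h
  refine ⟨∑ k ∈ Finset.range (n + 1), |C k| + 1, by positivity, fun k hk t ↦ ?_⟩
  have : |C k| ≤ ∑ k ∈ Finset.range (n + 1), |C k| :=
    Finset.single_le_sum (f := fun k ↦ |C k|) (fun _ _ ↦ abs_nonneg _) (by simp; omega)
  linarith [hC k t, le_abs_self (C k)]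

/-- The radius `2⁻ⁿ / 4` keeps the supports for different `n` disjoint and away from `0`. -/
theorem exists_dyadic_bump (n : ℕ) : ∃ b : ℝ → ℝ, ContDiff ℝ ∞ b ∧ HasCompactSupport b ∧
    (∀ s, |s| ≤ (1 / 2 : ℝ) ^ n / 8 → b ((1 / 2 : ℝ) ^ n + s) = 1) ∧
    ∀ t, (1 / 2 : ℝ) ^ n / 4 ≤ |t - (1 / 2 : ℝ) ^ n| → b t = 0 := by
  have hp : (0 : ℝ) < (1 / 2 : ℝ) ^ n := by positivity
  let f : ContDiffBump ((1 / 2 : ℝ) ^ n) := ⟨(1 / 2 : ℝ) ^ n / 8, (1 / 2 : ℝ) ^ n / 4,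
    by positivity, by linarith⟩
  refine ⟨f, f.contDiff, f.hasCompactSupport, fun s hs ↦ f.one_of_mem_closedBall ?_,
    fun t ht ↦ f.zero_of_le_dist ?_⟩
  · simpa [f] using hs
  · simpa [f, Real.dist_eq] using ht

variable {E : Type*} [NormedAddCommGroup E] [NormedSpace ℝ E]

theorem norm_iteratedFDeriv_smul_const_le {f : ℝ → ℝ} (hf : ContDiff ℝ ∞ f) (v : E) (k : ℕ)
    (t : ℝ) : ‖iteratedFDeriv ℝ k (fun t ↦ f t • v) t‖ ≤ ‖v‖ * ‖iteratedFDeriv ℝ k f t‖ := by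
  have := (ContinuousLinearMap.toSpanSingleton ℝ v).norm_iteratedFDeriv_comp_left
    (f := f) (x := t) (n := k) (N := ∞) hf.contDiffAt (by exact_mod_cast le_top)
  simpa [Function.comp_def] using this

/-- Special curve lemma: some smooth curve runs through given line segments converging fast to a
point. -/
theorem exists_special_curve [CompleteSpace E] {δ : ℝ} (hδ : 0 < δ) :
    ∃ ε r τ : ℕ → ℝ, (∀ j, 0 < ε j) ∧ (∀ j, 0 < r j) ∧
      Tendsto r atTop (𝓝 0) ∧ Tendsto τ atTop (𝓝 0) ∧
      ∀ (x : E) (y u : ℕ → E), (∀ j, ‖y j - x‖ ≤ ε j) → (∀ j, ‖u j‖ ≤ ε j) →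
        ∃ c : ℝ → E, ContDiff ℝ ∞ c ∧ c 0 = x ∧ (∀ t, c t ∈ Metric.ball x δ) ∧
          ∀ j s, |s| ≤ r j → c (τ j + s) = y j + s • u j := by
  choose b hb hbs hb1 hb0 using exists_dyadic_bump
  let τ : ℕ → ℝ := fun j ↦ (1 / 2) ^ j
  let m : ℕ → ℝ → ℝ := fun j t ↦ b j t * (t - τ j)
  have hm : ∀ j, ContDiff ℝ ∞ (m j) := fun j ↦ (hb j).mul (contDiff_id.sub contDiff_const)
  have hms : ∀ j, HasCompactSupport (m j) := fun j ↦ (hbs j).mul_right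
  choose C hC0 hC using fun j ↦ exists_bound_iteratedFDeriv (hb j) (hbs j) j
  choose C' hC0' hC' using fun j ↦ exists_bound_iteratedFDeriv (hm j) (hms j) j
  -- The scale `ε j` below makes the derivatives of order at most `j` of the `j`-th summand bounded
  -- by `κ 2⁻ʲ`. Hence the series converges with all derivatives, and its sum has norm at most `2 κ
  -- < δ`.
  let κ : ℝ := min 1 (δ / 4)
  have hκ : 0 < κ := by positivity
  refine ⟨fun j ↦ κ * (1 / 2) ^ j / (C j + C' j), fun j ↦ (1 / 2) ^ j / 8, τ, fun j ↦ ?_,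
    fun j ↦ by positivity, by
      simpa using (tendsto_pow_atTop_nhds_zero_of_lt_one (r := (1 / 2 : ℝ)) (by norm_num)
        (by norm_num)).div_const 8,
    tendsto_pow_atTop_nhds_zero_of_lt_one (by norm_num) (by norm_num),
    fun x y u hy hu ↦ ?_⟩
  · have := hC0 j
    have := hC0' j
    positivity
  let f : ℕ → ℝ → E := fun j t ↦ b j t • (y j - x) + m j t • u j
  have hf : ∀ j, ContDiff ℝ ∞ (f j) := fun j ↦
    ((hb j).smul contDiff_const).add ((hm j).smul contDiff_const)
  have hbound : ∀ j k, k ≤ j → ∀ t, ‖iteratedFDeriv ℝ k (f j) t‖ ≤ κ * (1 / 2) ^ j := by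
    intro j k hk t
    have hle : (k : WithTop ℕ∞) ≤ ∞ := by exact_mod_cast le_top
    have h1 : iteratedFDeriv ℝ k (f j) t = iteratedFDeriv ℝ k (fun t ↦ b j t • (y j - x)) t +
        iteratedFDeriv ℝ k (fun t ↦ m j t • u j) t :=
      iteratedFDeriv_add_apply
        (((hb j).smul contDiff_const).of_le hle).contDiffAt
        (((hm j).smul contDiff_const).of_le hle).contDiffAt
    rw [h1]
    refine (norm_add_le _ _).trans ?_
    have h2 := norm_iteratedFDeriv_smul_const_le (hb j) (y j - x) k t
    have h3 := norm_iteratedFDeriv_smul_const_le (hm j) (u j) k t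
    have h4 := mul_le_mul (hy j) (hC j k hk t) (norm_nonneg _) ((norm_nonneg _).trans (hy j))
    have h5 := mul_le_mul (hu j) (hC' j k hk t) (norm_nonneg _) ((norm_nonneg _).trans (hu j))
    have h6 : κ * (1 / 2) ^ j / (C j + C' j) * C j + κ * (1 / 2) ^ j / (C j + C' j) * C' j =
        κ * (1 / 2) ^ j := by
      have := hC0 j
      have := hC0' j
      field_simp
    linarith
  have hsum : Summable fun j : ℕ ↦ κ * (1 / 2 : ℝ) ^ j :=
    (summable_geometric_of_lt_one (by norm_num) (by norm_num)).mul_left κ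
  have hf0 : ∀ j t, ‖f j t‖ ≤ κ * (1 / 2) ^ j := fun j t ↦ by
    simpa using hbound j 0 (Nat.zero_le _) t
  have hfz : ∀ j t, (1 / 2 : ℝ) ^ j / 4 ≤ |t - (1 / 2) ^ j| → f j t = 0 := fun j t ht ↦ by
    simp [f, m, hb0 j t ht]
  refine ⟨fun t ↦ x + ∑' j, f j t, contDiff_const.add
    (contDiff_tsum_of_eventually (v := fun _ j ↦ κ * (1 / 2) ^ j) hf (fun _ _ ↦ hsum) ?_),
    ?_, fun t ↦ ?_, fun j s hs ↦ ?_⟩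
  · intro k _
    rw [Nat.cofinite_eq_atTop]
    exact eventually_atTop.2 ⟨k, fun j hj t ↦ hbound j k hj t⟩
  · have : ∀ j, f j 0 = 0 := fun j ↦ hfz j 0 (by
      have : (0 : ℝ) < (1 / 2) ^ j := by positivity
      rw [zero_sub, abs_neg, abs_of_pos this]
      linarith)
    simp [this]
  · have h1 : ‖∑' j, f j t‖ ≤ κ * 2 := by
      refine tsum_of_norm_bounded ?_ (fun j ↦ hf0 j t)
      exact (hasSum_geometric_two).mul_left κ
    have h2 : κ ≤ δ / 4 := min_le_right _ _
    rw [mem_ball_iff_norm, add_sub_cancel_left]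
    linarith
  · have hj : (0 : ℝ) < (1 / 2) ^ j := by positivity
    have hs' := abs_le.1 hs
    have h1 : ∀ i ≠ j, f i (τ j + s) = 0 := by
      intro i hij
      refine hfz i _ ?_
      simp only [τ]
      have hi : (0 : ℝ) < (1 / 2) ^ i := by positivity
      rcases lt_or_gt_of_ne hij with h | h
      · have h2 : (1 / 2 : ℝ) ^ j ≤ (1 / 2) ^ (i + 1) :=
          pow_le_pow_of_le_one (by norm_num) (by norm_num) h
        rw [pow_succ] at h2
        refine le_trans ?_ (neg_le_abs _)
        linarith
      · have h2 : (1 / 2 : ℝ) ^ i ≤ (1 / 2) ^ (j + 1) :=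
          pow_le_pow_of_le_one (by norm_num) (by norm_num) h
        rw [pow_succ] at h2
        refine le_trans ?_ (le_abs_self _)
        linarith
    simp only
    rw [tsum_eq_single j h1]
    have h2 : b j (τ j + s) = 1 := hb1 j s hs
    simp only [f, m, h2, add_sub_cancel_left, one_smul, one_mul]
    abel

/-- Preimages of `c^∞`-open sets under conveniently smooth maps on open sets are open. -/
theorem ConvSmoothOn.isOpen_inter_preimage [CompleteSpace E] {F : Type*} [AddCommGroup F]
    [Module ℝ F] [TopologicalSpace F] {f : E → F} {W : Set E} (hf : ConvSmoothOn f W)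
    (hW : IsOpen W) {V : Set F} (hV : IsCInftyOpen V) : IsOpen (W ∩ f ⁻¹' V) := by
  rw [isOpen_iff_mem_nhds]
  rintro x ⟨hxW, hxV⟩
  refine inter_mem (hW.mem_nhds hxW) ?_
  obtain ⟨δ, hδ, hδW⟩ := Metric.isOpen_iff.1 hW x hxW
  obtain ⟨ε, r, τ, hε, hr, hr0, hτ, H⟩ := exists_special_curve (E := E) hδ
  by_contra hcon
  -- If `x` were not interior, points outside the preimage would converge to `x` fast enough to lie
  -- on one smooth curve through `x`, along which the preimage is open.
  have h : ∀ j, ∃ y, ‖y - x‖ ≤ ε j ∧ f y ∉ V := by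
    intro j
    by_contra! hj
    refine hcon (mem_of_superset (Metric.ball_mem_nhds x (hε j)) fun y hy ↦ hj y ?_)
    exact (mem_ball_iff_norm.1 hy).le
  choose y hy hyV using h
  obtain ⟨c, hc, hc0, hcb, hcy⟩ := H x y 0 hy (fun j ↦ by simpa using (hε j).le)
  have hopen := hV _ (hf c (isSmoothCurve_iff_contDiff.2 hc) fun t ↦ hδW (hcb t))
  have h0 : (f ∘ c) ⁻¹' V ∈ 𝓝 (0 : ℝ) := hopen.mem_nhds (by simpa [hc0] using hxV)
  obtain ⟨j, hj⟩ := (hτ.eventually h0).exists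
  have := hcy j 0 (by simpa using (hr j).le)
  simp only [add_zero, zero_smul] at this
  refine hyV j ?_
  simpa [this] using hj

/-- Conveniently smooth maps between Banach spaces are locally Lipschitz. -/
theorem ConvSmoothOn.exists_lipschitzOnWith [CompleteSpace E] {F : Type*} [NormedAddCommGroup F]
    [NormedSpace ℝ F] {f : E → F} {W : Set E} (hf : ConvSmoothOn f W) (hW : IsOpen W) {x : E}
    (hx : x ∈ W) : ∃ K, ∃ N ∈ 𝓝 x, LipschitzOnWith K f N := by
  obtain ⟨δ, hδ, hδW⟩ := Metric.isOpen_iff.1 hW x hx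
  obtain ⟨ε, r, τ, hε, hr, hr0, hτ, H⟩ := exists_special_curve (E := E) hδ
  by_contra! hcon
  have h : ∀ j : ℕ, ∃ y z, ‖y - x‖ ≤ ε j ∧ ‖z - y‖ ≤ r j * ε j ∧
      (j / ε j) * ‖z - y‖ < ‖f z - f y‖ := by
    intro j
    have hpos : 0 < min (ε j) (r j * ε j / 2) := by
      have := hε j
      have := hr j
      positivity
    have h1 := hcon ⟨j / ε j, div_nonneg (Nat.cast_nonneg _) (hε j).le⟩ _
      (Metric.ball_mem_nhds x hpos)
    have h2 : ∃ z ∈ Metric.ball x (min (ε j) (r j * ε j / 2)),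
        ∃ y ∈ Metric.ball x (min (ε j) (r j * ε j / 2)),
          j / ε j * dist z y < dist (f z) (f y) := by
      by_contra! h2
      exact h1 (LipschitzOnWith.of_dist_le_mul h2)
    obtain ⟨z, hz, y, hy, hzy⟩ := h2
    rw [mem_ball_iff_norm] at hy hz
    refine ⟨y, z, hy.le.trans (min_le_left _ _), ?_, by simpa [dist_eq_norm] using hzy⟩
    have h2 := norm_sub_le (z - x) (y - x)
    rw [sub_sub_sub_cancel_right] at h2
    have := min_le_right (ε j) (r j * ε j / 2)
    linarith
  choose y z hy hzy hfzy using h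
  have hne : ∀ j, 0 < ‖z j - y j‖ := fun j ↦ by
    rw [norm_pos_iff]
    intro h0
    have := hfzy j
    rw [sub_eq_zero.1 h0] at this
    simp at this
  -- The velocity has norm exactly `ε j`, so the segment from `y j` to `z j` takes time `s j = ‖z j
  -- - y j‖ / ε j ≤ r j`. The increment of `f ∘ c` over that time exceeds `j * s j`, so `f ∘ c` is
  -- not Lipschitz near `0`.
  let u : ℕ → E := fun j ↦ (ε j / ‖z j - y j‖) • (z j - y j)
  obtain ⟨c, hc, hc0, hcb, hcy⟩ := H x y u hy (fun j ↦ by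
    rw [norm_smul, norm_div, norm_norm, div_mul_cancel₀ _ (hne j).ne']
    exact (Real.norm_of_nonneg (hε j).le).le)
  have hfc : ContDiff ℝ ∞ (f ∘ c) :=
    isSmoothCurve_iff_contDiff.1 (hf c (isSmoothCurve_iff_contDiff.2 hc) fun t ↦ hδW (hcb t))
  obtain ⟨K, N, hN, hK⟩ := (hfc.of_le (by exact_mod_cast le_top : (1 : WithTop ℕ∞) ≤ ∞)).contDiffAt
    (x := (0 : ℝ)) |>.exists_lipschitzOnWith
  let s : ℕ → ℝ := fun j ↦ ‖z j - y j‖ / ε j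
  have hs0 : ∀ j, 0 < s j := fun j ↦ div_pos (hne j) (hε j)
  have hsr : ∀ j, |s j| ≤ r j := fun j ↦ by
    rw [abs_of_pos (hs0 j), div_le_iff₀ (hε j)]
    exact hzy j
  have hcz : ∀ j, c (τ j + s j) = z j := fun j ↦ by
    rw [hcy j _ (hsr j), smul_smul, div_mul_div_cancel₀ (hε j).ne', div_self (hne j).ne']
    simp
  have hcy0 : ∀ j, c (τ j) = y j := fun j ↦ by
    simpa using hcy j 0 (by simpa using (hr j).le)
  have hs : Tendsto s atTop (𝓝 0) :=
    squeeze_zero (fun j ↦ (hs0 j).le) (fun j ↦ (le_abs_self _).trans (hsr j)) hr0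
  obtain ⟨n, hn⟩ := exists_nat_gt (K : ℝ)
  obtain ⟨j, hj1, hj2, hj⟩ := ((hτ.eventually hN).and
    (((by simpa using hτ.add hs : Tendsto (fun j ↦ τ j + s j) atTop (𝓝 0)).eventually hN).and
      (eventually_ge_atTop n))).exists
  have h1 := hK.dist_le_mul _ hj2 _ hj1
  simp only [Function.comp_apply, hcz, hcy0, dist_eq_norm, add_sub_cancel_left,
    Real.norm_eq_abs, abs_of_pos (hs0 j)] at h1
  have h2 := (hfzy j).trans_le h1
  rw [div_mul_eq_mul_div, mul_div_assoc] at h2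
  have h3 : (j : ℝ) < K := lt_of_mul_lt_mul_right h2 (hs0 j).le
  have h4 : (n : ℝ) ≤ j := by exact_mod_cast hj
  linarith

end SpecialCurve


/-! ### A differentiable no-retraction theorem for Lipschitz maps -/

section NoRetraction

open MeasureTheory

/-- A map that factors near `x` through a space of smaller dimension, by a differentiable map
followed by a Lipschitz one, has singular derivative at `x`. -/
theorem det_fderiv_eq_zero_of_factor {E F : Type*} [NormedAddCommGroup E] [NormedSpace ℝ E]
    [FiniteDimensional ℝ E] [NormedAddCommGroup F] [NormedSpace ℝ F] [FiniteDimensional ℝ F]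
    (hdim : Module.finrank ℝ F < Module.finrank ℝ E) {f : E → F} {Q : F → E} {G : E → E} {x : E}
    (hf : DifferentiableAt ℝ f x) {K : NNReal} {N : Set F} (hN : N ∈ 𝓝 (f x))
    (hQ : LipschitzOnWith K Q N) (hG : G =ᶠ[𝓝 x] Q ∘ f) (hGx : DifferentiableAt ℝ G x) :
    (fderiv ℝ G x).det = 0 := by
  have hker := LinearMap.ker_ne_bot_of_finrank_lt (f := (fderiv ℝ f x : E →ₗ[ℝ] F)) hdim
  obtain ⟨v, hv, hv0⟩ := Submodule.exists_mem_ne_zero_of_ne_bot hker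
  have hv' : fderiv ℝ f x v = 0 := hv
  have hfv : HasDerivAt (fun t : ℝ ↦ f (x + t • v)) 0 0 := by
    have := hf.hasFDerivAt.hasLineDerivAt v
    rwa [hv'] at this
  have hGv : HasDerivAt (fun t : ℝ ↦ G (x + t • v)) (fderiv ℝ G x v) 0 :=
    hGx.hasFDerivAt.hasLineDerivAt v
  have hline : Tendsto (fun t : ℝ ↦ x + t • v) (𝓝 0) (𝓝 x) :=
    (by fun_prop : Continuous fun t : ℝ ↦ x + t • v).tendsto' _ _ (by simp)
  -- Along a kernel vector `v` of the derivative, `f` moves by `o(t)`; the Lipschitz map `Q`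
  -- preserves this although it need not be differentiable.
  have hGv0 : HasDerivAt (fun t : ℝ ↦ G (x + t • v)) 0 0 := by
    rw [hasDerivAt_iff_isLittleO] at hfv ⊢
    refine Asymptotics.IsBigO.trans_isLittleO ?_ hfv
    refine Asymptotics.IsBigO.of_bound K ?_
    filter_upwards [hline.eventually hG, (hf.continuousAt.tendsto.comp hline).eventually hN]
      with t h1 h2
    simpa [h1, hG.self_of_nhds, dist_eq_norm] using hQ.dist_le_mul _ h2 _ (mem_of_mem_nhds hN)
  have hGv' : fderiv ℝ G x v = 0 := hGv.unique hGv0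
  by_contra hdet
  have hu : IsUnit (LinearMap.det (fderiv ℝ G x : E →ₗ[ℝ] E)) := isUnit_iff_ne_zero.2 hdet
  have hinj := (LinearEquiv.ofIsUnitDet (v := Module.finBasis ℝ E) (v' := Module.finBasis ℝ E)
    (f := (fderiv ℝ G x : E →ₗ[ℝ] E)) (by
      rw [LinearMap.det_toMatrix]; exact hu)).injective
  exact hv0 (hinj (by simpa using hGv'))

/-- The determinant of `1 + t A` is a polynomial in `t`, so its value at `1` is an affine
combination of its values at sufficiently many other points. -/
theorem exists_weights (n : ℕ) {v : Fin (n + 1) → ℝ} (hv : Function.Injective v) :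
    ∃ w : Fin (n + 1) → ℝ, ∑ j, w j = 1 ∧ ∀ (E : Type*) [NormedAddCommGroup E] [NormedSpace ℝ E]
      [FiniteDimensional ℝ E], Module.finrank ℝ E = n → ∀ A : E →L[ℝ] E,
      (1 + A).det = ∑ j, w j * (1 + v j • A).det := by
  -- Lagrange interpolation at the `n + 1` nodes is exact in degree at most `n`; the weights
  -- evaluate it at `1`.
  let w : Fin (n + 1) → ℝ := fun j ↦ (Lagrange.basis Finset.univ v j).eval 1
  have hw : ∀ p : Polynomial ℝ, p.natDegree ≤ n → p.eval 1 = ∑ j, w j * p.eval (v j) := by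
    intro p hp
    have h := Lagrange.eq_interpolate (s := Finset.univ) (v := v) (f := p) hv.injOn
      (lt_of_le_of_lt Polynomial.degree_le_natDegree (by
        simp only [Finset.card_univ, Fintype.card_fin]
        exact_mod_cast Nat.lt_succ_of_le hp))
    conv_lhs => rw [h]
    rw [Lagrange.interpolate_apply, Polynomial.eval_finsetSum]
    exact Finset.sum_congr rfl fun j _ ↦ by simp [w, mul_comm]
  refine ⟨w, by simpa using (hw 1 (by simp)).symm, fun E _ _ _ hE A ↦ ?_⟩
  let b := Module.finBasis ℝ E
  let B := LinearMap.toMatrix b b (A : E →ₗ[ℝ] E)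
  let p : Polynomial ℝ := ((Polynomial.X : Polynomial ℝ) • B.map Polynomial.C +
    (1 : Matrix _ _ ℝ).map Polynomial.C).det
  have hp : ∀ t : ℝ, p.eval t = (1 + t • A).det := by
    intro t
    have h1 : (1 + t • A).det = LinearMap.det ((1 : E →ₗ[ℝ] E) + t • (A : E →ₗ[ℝ] E)) := rfl
    rw [h1, ← LinearMap.det_toMatrix b]
    simp only [p, ← Polynomial.coe_evalRingHom, RingHom.map_det]
    congr 1
    ext i j
    obtain rfl | hij := eq_or_ne i j
    · simp [B, LinearMap.toMatrix_one, add_comm, mul_comm t]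
    · simp [B, LinearMap.toMatrix_one, hij, mul_comm t]
  have := hw p ((Polynomial.natDegree_det_X_add_C_le B 1).trans (by simp [hE]))
  simpa [hp] using this

/-- If `g` is Lipschitz on the closed unit ball and vanishes on the unit sphere, its extension by
zero is Lipschitz. -/
theorem lipschitzWith_indicator_closedBall {E F : Type*} [NormedAddCommGroup E] [NormedSpace ℝ E]
    [NormedAddCommGroup F] {g : E → F} {K : NNReal}
    (hg : LipschitzOnWith K g (Metric.closedBall 0 1)) (h0 : ∀ x, ‖x‖ = 1 → g x = 0) :
    LipschitzWith K ((Metric.closedBall 0 1).indicator g) := by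
  have key : ∀ x y : E, ‖x‖ ≤ 1 → 1 < ‖y‖ → ‖g x‖ ≤ K * dist x y := by
    intro x y hx hy
    have hcont : ContinuousOn (fun t : ℝ ↦ ‖x + t • (y - x)‖) (Icc 0 1) := by fun_prop
    -- The segment from `x` to `y` crosses the unit sphere, where `g` vanishes; the Lipschitz bound
    -- is needed only up to the crossing.
    obtain ⟨t, ht, ht1⟩ := intermediate_value_Icc zero_le_one hcont
      (show (1 : ℝ) ∈ Icc _ _ by simpa using ⟨hx, hy.le⟩)
    simp only at ht1
    have h1 := hg.dist_le_mul x (by simpa using hx) (x + t • (y - x)) (by simpa using ht1.le)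
    rw [h0 _ ht1, dist_zero_right, dist_eq_norm, sub_add_cancel_left, norm_neg, norm_smul,
      Real.norm_of_nonneg ht.1] at h1
    rw [dist_comm, dist_eq_norm]
    refine h1.trans ?_
    gcongr
    exact mul_le_of_le_one_left (norm_nonneg _) ht.2
  refine LipschitzWith.of_dist_le_mul fun x y ↦ ?_
  by_cases hx : ‖x‖ ≤ 1 <;> by_cases hy : ‖y‖ ≤ 1
  · rw [indicator_of_mem (by simpa using hx), indicator_of_mem (by simpa using hy)]
    exact hg.dist_le_mul x (by simpa using hx) y (by simpa using hy)
  · rw [indicator_of_mem (by simpa using hx), indicator_of_notMem (by simpa using hy)]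
    simpa using key x y hx (not_le.1 hy)
  · rw [indicator_of_notMem (by simpa using hx), indicator_of_mem (by simpa using hy), dist_comm x]
    simpa [dist_comm] using key y x hy (not_le.1 hx)
  · rw [indicator_of_notMem (by simpa using hx), indicator_of_notMem (by simpa using hy)]
    simp only [dist_self]
    positivity

/-- Top-dimensional Hausdorff measure is a Haar measure, so it has the same null sets as `μ`, and
Lipschitz maps scale it by at most a constant. -/
theorem addHaar_image_eq_zero_of_lipschitz {E : Type*} [NormedAddCommGroup E] [NormedSpace ℝ E]
    [FiniteDimensional ℝ E] [MeasurableSpace E] [BorelSpace E] (μ : Measure E)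
    [μ.IsAddHaarMeasure] {f : E → E} {K : NNReal} (hf : LipschitzWith K f) {s : Set E}
    (hs : μ s = 0) : μ (f '' s) = 0 := by
  have := MeasureTheory.isAddHaarMeasure_hausdorffMeasure (E := E)
  have h1 : (μH[Module.finrank ℝ E] : Measure E) s = 0 :=
    Measure.absolutelyContinuous_isAddHaarMeasure _ μ hs
  refine Measure.absolutelyContinuous_isAddHaarMeasure μ (μH[Module.finrank ℝ E] : Measure E) ?_
  have h2 := hf.hausdorffMeasure_image_le (Nat.cast_nonneg (Module.finrank ℝ E)) s
  simpa [h1] using h2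

/-- Small Lipschitz perturbations of the identity supported in a set preserve that set. -/
theorem image_eq_of_perturbation {E : Type*} [NormedAddCommGroup E] [NormedSpace ℝ E]
    [CompleteSpace E] {h : E → E} {K : NNReal} (hh : LipschitzWith K h) (hK : K < 1) {s : Set E}
    (hs : ∀ x ∉ s, h x = 0) :
    Function.Injective (fun x ↦ x + h x) ∧ (fun x ↦ x + h x) '' s = s := by
  have hinj : Function.Injective (fun x ↦ x + h x) := by
    intro x y hxy
    have h1 : dist x y ≤ K * dist x y := by
      have h2 := hh.dist_le_mul x y
      have h3 : x - y = -(h x - h y) := by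
        have : x + h x = y + h y := hxy
        rw [neg_sub, sub_eq_sub_iff_add_eq_add, this, add_comm]
      rwa [dist_eq_norm (h x), ← norm_neg, ← h3, ← dist_eq_norm] at h2
    have hK' : (K : ℝ) < 1 := hK
    by_contra hne
    have := dist_pos.2 hne
    nlinarith
  have hsurj : Function.Surjective (fun x ↦ x + h x) := by
    intro y
    -- A preimage of `y` is a fixed point of the contraction `x ↦ y - h x`.
    have hc : ContractingWith K (fun x ↦ y - h x) := by
      refine ⟨hK, LipschitzWith.of_dist_le_mul fun a b ↦ ?_⟩
      rw [dist_sub_left]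
      exact hh.dist_le_mul a b
    exact ⟨hc.fixedPoint, by
      have := hc.fixedPoint_isFixedPt
      exact (sub_eq_iff_eq_add.1 this).symm⟩
  refine ⟨hinj, Subset.antisymm ?_ ?_⟩
  · rintro _ ⟨x, hx, rfl⟩
    by_contra hcon
    have h1 := hs _ hcon
    have : x + h x = x := hinj (by simp only [h1, add_zero])
    exact hcon (by simpa [this] using hx)
  · intro y hy
    obtain ⟨x, rfl⟩ := hsurj y
    by_cases hx : x ∈ s
    · exact ⟨x, hx, rfl⟩
    · simp only [hs x hx, add_zero] at hy
      exact absurd hy hx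

/-- The Jacobian integral of a small Lipschitz perturbation of the identity supported in the unit
ball. -/
theorem integral_det_one_add_fderiv {E : Type*} [NormedAddCommGroup E] [NormedSpace ℝ E]
    [FiniteDimensional ℝ E] [MeasurableSpace E] [BorelSpace E] (μ : Measure E)
    [μ.IsAddHaarMeasure] {g : E → E} {K : NNReal} (hg : LipschitzWith K g)
    (hgout : ∀ x ∉ Metric.ball (0 : E) 1, g x = 0) (hK : K < 1)
    (hpos : ∀ A : E →L[ℝ] E, ‖A‖ ≤ K → 0 < (1 + A).det) {s : Set E} (hsm : MeasurableSet s)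
    (hsB : s ⊆ Metric.ball 0 1) (hs : ∀ x ∈ s, DifferentiableAt ℝ g x)
    (hdiff : μ (Metric.ball 0 1 \ s) = 0) :
    IntegrableOn (fun x ↦ (1 + fderiv ℝ g x).det) s μ ∧
      ∫ x in s, (1 + fderiv ℝ g x).det ∂μ = (μ (Metric.ball 0 1)).toReal := by
  obtain ⟨hinj, himg⟩ := image_eq_of_perturbation hg hK hgout
  have hvol : μ ((fun x ↦ x + g x) '' s) = μ (Metric.ball 0 1) := by
    refine le_antisymm ?_ ?_
    · conv_rhs => rw [← himg]
      exact measure_mono (image_mono hsB)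
    · have h1 : Metric.ball 0 1 ⊆
          (fun x ↦ x + g x) '' s ∪ (fun x ↦ x + g x) '' (Metric.ball 0 1 \ s) := by
        rw [← image_union, union_sdiff_cancel hsB, himg]
      refine (measure_mono h1).trans ((measure_union_le _ _).trans ?_)
      have h2 : μ ((fun x ↦ x + g x) '' (Metric.ball 0 1 \ s)) = 0 :=
        addHaar_image_eq_zero_of_lipschitz μ (LipschitzWith.id.add hg) hdiff
      rw [h2, add_zero]
  have hderiv : ∀ x ∈ s, HasFDerivWithinAt (fun x ↦ x + g x) (1 + fderiv ℝ g x) s x := fun x hx ↦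
    ((hasFDerivAt_id x).add (hs x hx).hasFDerivAt).hasFDerivWithinAt
  have hlint := lintegral_abs_det_fderiv_eq_addHaar_image μ hsm hderiv hinj.injOn
  rw [hvol] at hlint
  have hnn : ∀ x, 0 < (1 + fderiv ℝ g x).det := fun x ↦ hpos _ (norm_fderiv_le_of_lipschitz ℝ hg)
  have hmeas : Measurable fun x ↦ (1 + fderiv ℝ g x).det := by
    have hc : Continuous fun A : E →L[ℝ] E ↦ (1 + A).det :=
      ContinuousLinearMap.continuous_det.comp (by fun_prop)
    exact hc.measurable.comp (measurable_fderiv ℝ g)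
  simp only [fun x ↦ abs_of_pos (hnn x)] at hlint
  constructor
  · refine ⟨hmeas.aestronglyMeasurable, ?_⟩
    rw [hasFiniteIntegral_iff_ofReal (Eventually.of_forall fun x ↦ (hnn x).le), hlint]
    exact measure_ball_lt_top
  · rw [integral_eq_lintegral_of_nonneg_ae (Eventually.of_forall fun x ↦ (hnn x).le)
      hmeas.aestronglyMeasurable, hlint]

/-- Positivity removes the absolute value from the change of variables formula, so that the
integrand becomes polynomial in the scaling parameter. -/
theorem exists_forall_det_one_add_pos (E : Type*) [NormedAddCommGroup E] [NormedSpace ℝ E]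
    [FiniteDimensional ℝ E] : ∃ ε > 0, ∀ A : E →L[ℝ] E, ‖A‖ < ε → 0 < (1 + A).det := by
  have hc : Continuous fun A : E →L[ℝ] E ↦ (1 + A).det :=
    ContinuousLinearMap.continuous_det.comp (by fun_prop)
  have h0 : 0 < (1 + (0 : E →L[ℝ] E)).det := by
    rw [add_zero]
    show 0 < LinearMap.det (LinearMap.id : E →ₗ[ℝ] E)
    simp
  obtain ⟨ε, hε, h⟩ := Metric.eventually_nhds_iff.1 (hc.continuousAt.eventually (lt_mem_nhds h0))
  exact ⟨ε, hε, fun A hA ↦ h (by simpa using hA)⟩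

theorem exists_injective_small (n : ℕ) (K : NNReal) {ε : ℝ} (hε : 0 < ε) :
    ∃ v : Fin (n + 1) → NNReal, Function.Injective v ∧ ∀ j, (v j : ℝ) * K < ε := by
  refine ⟨fun j ↦ ⟨(ε / (K + 1)) * (1 / (j + 2)), by positivity⟩, fun i j hij ↦ ?_, fun j ↦ ?_⟩
  · have h1 : ε / ((K : ℝ) + 1) ≠ 0 := by positivity
    have h2 := mul_left_cancel₀ h1 (congrArg NNReal.toReal hij)
    rw [one_div, one_div, inv_inj, add_left_inj] at h2
    exact Fin.ext (by exact_mod_cast h2)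
  · have h1 : (0 : ℝ) ≤ (j : ℕ) := Nat.cast_nonneg _
    have h2 : (1 : ℝ) / ((j : ℕ) + 2) ≤ 1 := by
      rw [div_le_one (by positivity)]; linarith
    have h3 : ε / ((K : ℝ) + 1) * K < ε := by
      rw [div_mul_eq_mul_div, div_lt_iff₀ (by positivity)]
      nlinarith
    refine lt_of_le_of_lt ?_ h3
    have h4 : 0 ≤ ε / ((K : ℝ) + 1) := by positivity
    exact mul_le_mul_of_nonneg_right (mul_le_of_le_one_right h4 h2) K.2

/-- A locally Lipschitz self-map of a finite-dimensional normed space which is the identity on the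
unit sphere cannot have singular derivative at all points of differentiability. -/
theorem exists_det_fderiv_ne_zero {E : Type*} [NormedAddCommGroup E] [NormedSpace ℝ E]
    [FiniteDimensional ℝ E] {G : E → E}
    (hG : LocallyLipschitz G) (hid : ∀ x, ‖x‖ = 1 → G x = x) :
    ∃ x, DifferentiableAt ℝ G x ∧ (fderiv ℝ G x).det ≠ 0 := by
  by_contra! hdet
  borelize E
  let μ : Measure E := Measure.addHaar
  obtain ⟨K₀, hK₀⟩ := (hG.locallyLipschitzOn (s := Metric.closedBall (0 : E) 1)
    ).exists_lipschitzOnWith_of_compact (isCompact_closedBall _ _)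
  let g : E → E := (Metric.closedBall 0 1).indicator (fun x ↦ G x - x)
  obtain ⟨K, hg⟩ : ∃ K, LipschitzWith K g := by
    refine ⟨K₀ + 1, lipschitzWith_indicator_closedBall (hK₀.sub ?_) fun x hx ↦ by simp [hid x hx]⟩
    exact LipschitzWith.id.lipschitzOnWith
  have hgout : ∀ x ∉ Metric.ball (0 : E) 1, g x = 0 := by
    intro x hx
    by_cases h : x ∈ Metric.closedBall (0 : E) 1
    · have : ‖x‖ = 1 := le_antisymm (by simpa using h) (by simpa using hx)
      simp [g, hid x this]
    · exact indicator_of_notMem h _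
  have hgG : ∀ x ∈ Metric.ball (0 : E) 1, g =ᶠ[𝓝 x] fun x ↦ G x - x := fun x hx ↦ by
    filter_upwards [Metric.isOpen_ball.mem_nhds hx] with y hy
    exact indicator_of_mem (Metric.ball_subset_closedBall hy) _
  clear_value g
  let s : Set E := Metric.ball 0 1 ∩ {x | DifferentiableAt ℝ g x}
  have hsm : MeasurableSet s :=
    Metric.isOpen_ball.measurableSet.inter (measurableSet_of_differentiableAt ℝ g)
  have hdiff : μ (Metric.ball 0 1 \ s) = 0 := by
    refine measure_mono_null ?_ (ae_iff.1 (hg.ae_differentiableAt (μ := μ)))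
    rintro x ⟨hx, hxs⟩ hd
    exact hxs ⟨hx, hd⟩
  obtain ⟨ε, hε, hεdet⟩ := exists_forall_det_one_add_pos E
  -- One node more than the degree of `det (1 + t Dg)` in `t`, each small enough that `id + v j • g`
  -- is bijective with positive Jacobian.
  obtain ⟨v, hv, hvε⟩ := exists_injective_small (Module.finrank ℝ E) K (lt_min one_pos hε)
  have hint : ∀ j, IntegrableOn (fun x ↦ (1 + (v j : ℝ) • fderiv ℝ g x).det) s μ ∧
      ∫ x in s, (1 + (v j : ℝ) • fderiv ℝ g x).det ∂μ = (μ (Metric.ball 0 1)).toReal := by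
    intro j
    have hlip : LipschitzWith (v j * K) ((v j : ℝ) • g) := by
      refine LipschitzWith.of_dist_le_mul fun x y ↦ ?_
      rw [Pi.smul_apply, Pi.smul_apply, dist_smul₀, NNReal.norm_eq, NNReal.coe_mul, mul_assoc]
      exact mul_le_mul_of_nonneg_left (hg.dist_le_mul x y) (v j).2
    have := integral_det_one_add_fderiv μ hlip (fun x hx ↦ by simp [hgout x hx])
      (show (v j : ℝ) * (K : ℝ) < 1 from (hvε j).trans_le (min_le_left _ _))
      (fun A hA ↦ hεdet A (hA.trans_lt ((hvε j).trans_le (min_le_right _ _)))) hsm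
      inter_subset_left (fun x hx ↦ hx.2.const_smul _) hdiff
    simpa only [fderiv_const_smul_field, Pi.smul_apply] using this
  obtain ⟨w, hw1, hw⟩ := exists_weights (Module.finrank ℝ E)
    (v := fun j ↦ (v j : ℝ)) (NNReal.coe_injective.comp hv)
  have h1 : ∫ x in s, (1 + fderiv ℝ g x).det ∂μ = (μ (Metric.ball 0 1)).toReal := by
    have h0 : ∀ x, (1 + fderiv ℝ g x).det = _ := fun x ↦ hw E rfl (fderiv ℝ g x)
    simp only [h0]
    rw [integral_finsetSum _ fun j _ ↦ (hint j).1.const_mul _]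
    simp only [integral_const_mul, (hint _).2]
    rw [← Finset.sum_mul, hw1, one_mul]
  -- On the ball `1 + Dg = DG`, which is singular by assumption.
  have h2 : ∀ x ∈ s, (1 + fderiv ℝ g x).det = 0 := by
    intro x hx
    have hGx : DifferentiableAt ℝ G x := by
      have h3 : DifferentiableAt ℝ (fun x ↦ G x - x) x := hx.2.congr_of_eventuallyEq
        (hgG x hx.1).symm
      simpa using h3.add (differentiableAt_id (x := x))
    have h3 : fderiv ℝ g x = fderiv ℝ G x - 1 := by
      rw [(hgG x hx.1).fderiv_eq]
      exact (hGx.hasFDerivAt.sub (hasFDerivAt_id x)).fderiv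
    rw [h3, add_sub_cancel]
    exact hdet x hGx
  rw [setIntegral_congr_fun hsm h2] at h1
  simp only [integral_zero] at h1
  exact (ENNReal.toReal_pos (Metric.measure_ball_pos μ (0 : E) one_pos).ne'
    measure_ball_lt_top.ne).ne h1

end NoRetraction


/-! ### The `D`-topology of the skeleta in charts -/

section Reparam

variable {F : Type*} [AddCommGroup F] [Module ℝ F] [TopologicalSpace F] [IsTopologicalAddGroup F]
  [ContinuousSMul ℝ F]

/-- To test `c^∞`-openness of a subset of a `c^∞`-open set `O`, curves in `O` suffice. -/
theorem isCInftyOpen_of_subset {O V : Set F} (hO : IsCInftyOpen O) (hVO : V ⊆ O)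
    (H : ∀ c : ℝ → F, IsSmoothCurve c → (∀ t, c t ∈ O) → c 0 ∈ V → c ⁻¹' V ∈ 𝓝 0) :
    IsCInftyOpen V := by
  intro c hc
  rw [isOpen_iff_mem_nhds]
  intro t ht
  obtain ⟨η, hη, hηO, hη0, hηN⟩ := exists_reparam (hO c hc) (t := t) (hVO ht)
  refine mem_of_superset (hηN _ (H (c ∘ η) (hc.comp hη) hηO (by simpa [hη0] using ht))) ?_
  rintro _ ⟨s, hs, rfl⟩
  exact hs

end Reparam

theorem skeleton_le {X : Type*} (d : ℕ) (D : DiffeologicalSpace X) : skeleton d D ≤ D :=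
  DiffeologicalSpace.generateFrom_le_iff.2 fun _ _ hp ↦ hp.2

theorem isOpen_skeleton {X : Type*} (d : ℕ) {D : DiffeologicalSpace X} {U : Set X}
    (hU : IsOpen[D.dTopology] U) : IsOpen[(skeleton d D).dTopology] U := by
  refine (@isOpen_iff_preimages_plots X (skeleton d D) _).2 fun n p hp ↦ ?_
  exact (@isOpen_iff_preimages_plots X D _).1 hU n p
    (DiffeologicalSpace.le_iff'.1 (skeleton_le d D) n p hp)

namespace ConvAtlas

variable {M : Type*} {ι : Type*} {E : ι → Type*} [∀ i, AddCommGroup (E i)]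
  [∀ i, Module ℝ (E i)] [∀ i, TopologicalSpace (E i)] (A : ConvAtlas M E)

theorem isPlot_chart_symm (i : ι) {n : ℕ} {g : EuclideanSpace ℝ (Fin n) → E i}
    (hg : ConvSmoothOn g univ) (hgt : ∀ x, g x ∈ (A.chart i).target) :
    @IsPlot M A.diffeology n ((A.chart i).symm ∘ g) := by
  intro x _ j hj
  have hopen := hg.isOpen_inter_preimage isOpen_univ (A.isCInftyOpen_overlap i j)
  rw [univ_inter] at hopen
  refine ⟨_, subset_univ _, hopen, ?_, fun y hy ↦ ?_, fun c hc hcW ↦ ?_⟩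
  · simpa [PartialEquiv.trans_source] using ⟨hgt x, hj⟩
  · simp only [PartialEquiv.trans_source, PartialEquiv.symm_source, mem_preimage, mem_inter_iff]
      at hy
    exact hy.2
  · exact A.smooth_overlap i j (g ∘ c) (hg c hc fun _ ↦ trivial) hcW

theorem isOpen_of_isCInftyOpen (i : ι) {V : Set (E i)} (hV : IsCInftyOpen V) :
    IsOpen[A.diffeology.dTopology] ((A.chart i).source ∩ A.chart i ⁻¹' V) := by
  refine (@isOpen_iff_preimages_plots M A.diffeology _).2 fun n p hp ↦ ?_
  rw [isOpen_iff_mem_nhds]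
  rintro x ⟨hx, hxV⟩
  obtain ⟨W, -, hW, hxW, hm, hs⟩ := hp x trivial i hx
  refine mem_of_superset ((hs.isOpen_inter_preimage hW hV).mem_nhds ⟨hxW, hxV⟩) ?_
  exact fun y hy ↦ ⟨hm hy.1, hy.2⟩

theorem isOpen_source (i : ι) : IsOpen[A.diffeology.dTopology] (A.chart i).source := by
  simpa using A.isOpen_of_isCInftyOpen i (V := univ) fun _ _ ↦ isOpen_univ

variable [∀ i, IsTopologicalAddGroup (E i)] [∀ i, ContinuousSMul ℝ (E i)] {d : ℕ}

theorem isPlot_skeleton_curve (hd : 0 < d) (i : ι) {c : ℝ → E i} (hc : IsSmoothCurve c)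
    (hct : ∀ t, c t ∈ (A.chart i).target) :
    @IsPlot M (skeleton d A.diffeology) 1
      (fun z : EuclideanSpace ℝ (Fin 1) ↦ (A.chart i).symm (c (z 0))) := by
  refine DiffeologicalSpace.isPlot_generatedFrom_of_mem ⟨hd, ?_⟩
  refine A.isPlot_chart_symm i (g := fun z : EuclideanSpace ℝ (Fin 1) ↦ c (z 0))
    (fun k hk _ ↦ ?_) fun z ↦ hct _
  rw [isSmoothCurve_iff_contDiff] at hk
  exact hc.comp (η := fun t ↦ k t 0) (by fun_prop)

/-- Smooth curves in a chart are plots of dimension `1 ≤ d`, so the skeleton already sees the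
`c^∞`-topology. With `isOpen_of_isCInftyOpen` and `isOpen_skeleton`, the `D`-topologies of `M` and
`M_d` are thus both described by `c^∞`-open sets in charts. -/
theorem isCInftyOpen_of_isOpen_skeleton (hd : 0 < d) (i : ι) {V : Set M}
    (hV : IsOpen[(skeleton d A.diffeology).dTopology] V) :
    IsCInftyOpen ((A.chart i).target ∩ (A.chart i).symm ⁻¹' V) := by
  refine isCInftyOpen_of_subset (A.isCInftyOpen_target i) inter_subset_left
    fun c hc hct h0 ↦ ?_
  have h1 := (@isOpen_iff_preimages_plots M (skeleton d A.diffeology) _).1 hV 1 _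
    (A.isPlot_skeleton_curve hd i hc hct)
  have hcont : Continuous fun t : ℝ ↦ t • EuclideanSpace.single (0 : Fin 1) (1 : ℝ) := by fun_prop
  refine mem_of_superset ((h1.preimage hcont).mem_nhds ?_) fun t ht ↦ ?_
  · simpa using h0.2
  · exact ⟨hct t, by simpa using ht⟩

end ConvAtlas

/-! ### Contractible neighbourhoods -/

section Star

variable {F : Type*} [AddCommGroup F] [Module ℝ F] 
/-- The largest subset of `W` that is star-shaped about `x`. -/
def starCore (x : F) (W : Set F) : Set F := {v | ∀ t ∈ Icc (0 : ℝ) 1, x + t • (v - x) ∈ W}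

theorem starCore_subset (x : F) (W : Set F) : starCore x W ⊆ W := fun v hv ↦ by
  simpa using hv 1 (by simp)

theorem self_mem_starCore {x : F} {W : Set F} (hx : x ∈ W) : x ∈ starCore x W := fun t _ ↦ by
  simpa using hx

theorem homothety_mem_starCore {x v : F} {W : Set F} (hv : v ∈ starCore x W) {s : ℝ}
    (hs : s ∈ Icc (0 : ℝ) 1) : x + s • (v - x) ∈ starCore x W := fun t ht ↦ by
  simpa [smul_smul] using hv (t * s)
    ⟨mul_nonneg ht.1 hs.1, mul_le_one₀ ht.2 hs.1 hs.2⟩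

variable [TopologicalSpace F] [IsTopologicalAddGroup F] [ContinuousSMul ℝ F]

theorem IsSmoothCurve.convSmoothOn_homothety {c : ℝ → F} (hc : IsSmoothCurve c) (x : F) :
    ConvSmoothOn (fun z : ℝ × ℝ ↦ x + z.2 • (c z.1 - x)) univ := by
  intro k hk _
  rw [isSmoothCurve_iff_contDiff] at hk
  have h1 : IsSmoothCurve (fun t ↦ (k t).2 • (c + fun _ ↦ -x : ℝ → F) ((k t).1)) :=
    (hc.add (isSmoothCurve_const (-x))).smul_comp hk.snd hk.fst
  convert! (isSmoothCurve_const x).add h1 using 1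
  funext t
  simp [sub_eq_add_neg]

/-- Along a curve `c`, the homothety is a smooth map on `ℝ × ℝ`, hence pulls `W` back to an open
set; compactness of `[0, 1]` then gives a tube around a fibre. -/
theorem isCInftyOpen_starCore (x : F) {W : Set F} (hW : IsCInftyOpen W) :
    IsCInftyOpen (starCore x W) := by
  intro c hc
  have h1 := (hc.convSmoothOn_homothety x).isOpen_inter_preimage isOpen_univ hW
  rw [univ_inter] at h1
  rw [isOpen_iff_eventually]
  intro s hs
  refine (isCompact_Icc (a := (0 : ℝ)) (b := 1)).eventually_forall_of_forall_eventually fun t ht ↦ ?_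
  exact h1.mem_nhds (hs t ht)

end Star

namespace ConvAtlas

variable {M : Type*} {ι : Type*} {E : ι → Type*} [∀ i, AddCommGroup (E i)]
  [∀ i, Module ℝ (E i)] [∀ i, TopologicalSpace (E i)] (A : ConvAtlas M E)
  [∀ i, IsTopologicalAddGroup (E i)] [∀ i, ContinuousSMul ℝ (E i)] {d : ℕ}

theorem hasContractibleOpenBasis_skeleton (hd : 0 < d) :
    @HasContractibleOpenBasis M (skeleton d A.diffeology).dTopology := by
  let _ : TopologicalSpace M := (skeleton d A.diffeology).dTopology
  intro x U hU hxU
  obtain ⟨i, hi⟩ := A.cover x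
  let φ := A.chart i
  let W : Set (E i) := φ.target ∩ φ.symm ⁻¹' U
  have hxW : φ x ∈ W := ⟨φ.map_source hi, by simpa [φ.left_inv hi] using hxU⟩
  have hW : IsCInftyOpen W := A.isCInftyOpen_of_isOpen_skeleton hd i hU
  let S := starCore (φ x) W
  have hS : IsCInftyOpen S := isCInftyOpen_starCore _ hW
  have hSt : S ⊆ φ.target := (starCore_subset _ _).trans inter_subset_left
  let V : Set M := φ.source ∩ φ ⁻¹' S
  have hV : IsOpen V := isOpen_skeleton d (A.isOpen_of_isCInftyOpen i hS)
  have hmem : ∀ {v}, v ∈ S → φ.symm v ∈ V := fun hv ↦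
    ⟨φ.map_target (hSt hv), by simpa [φ.right_inv (hSt hv)] using hv⟩
  have hxV : x ∈ V := ⟨hi, self_mem_starCore hxW⟩
  refine ⟨V, fun y hy ↦ ?_, hV, hxV, ?_⟩
  · simpa [φ.left_inv hy.1] using (starCore_subset _ _ hy.2).2
  -- continuity on `V` can be tested along smooth curves in the chart
  have hcont : ∀ {Y : Type _} [TopologicalSpace Y] (g : V → Y),
      (∀ (c : ℝ → E i) (_ : IsSmoothCurve c) (hcS : ∀ t, c t ∈ S),
        Continuous fun t ↦ g ⟨φ.symm (c t), hmem (hcS t)⟩) → Continuous g := by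
    intro Y _ g hg
    refine continuous_def.2 fun O hO ↦ ?_
    have h1 : IsCInftyOpen {v | ∃ hv : v ∈ S, g ⟨φ.symm v, hmem hv⟩ ∈ O} := by
      refine isCInftyOpen_of_subset hS (fun v hv ↦ hv.1) fun c hc hcS h0 ↦ ?_
      refine mem_of_superset ((hO.preimage (hg c hc hcS)).mem_nhds h0.2) fun t ht ↦ ?_
      exact ⟨hcS t, ht⟩
    have h2 : IsOpen (φ.source ∩ φ ⁻¹' {v | ∃ hv : v ∈ S, g ⟨φ.symm v, hmem hv⟩ ∈ O}) :=
      isOpen_skeleton d (A.isOpen_of_isCInftyOpen i h1)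
    convert! h2.preimage continuous_subtype_val using 1
    ext ⟨y, hy⟩
    have hy' : φ.symm (φ y) = y := φ.left_inv hy.1
    simp only [mem_preimage, mem_inter_iff, mem_ofPred_eq, hy']
    exact ⟨fun h ↦ ⟨hy.1, hy.2, h⟩, fun h ↦ h.2.2⟩
  let κ : V → unitInterval → V := fun v t ↦
    ⟨φ.symm (φ x + (t : ℝ) • (φ v - φ x)), hmem (homothety_mem_starCore v.2.2 t.2)⟩
  have hκ : ∀ (c : ℝ → E i) (_ : IsSmoothCurve c) (hcS : ∀ t, c t ∈ S),
      Continuous fun z : ℝ × unitInterval ↦ κ ⟨φ.symm (c z.1), hmem (hcS z.1)⟩ z.2 := by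
    intro c hc hcS
    refine continuous_induced_rng.2 (continuous_def.2 fun O hO ↦ ?_)
    have h1 := (hc.convSmoothOn_homothety (φ x)).isOpen_inter_preimage isOpen_univ
      (A.isCInftyOpen_of_isOpen_skeleton hd i hO)
    rw [univ_inter] at h1
    convert! h1.preimage (continuous_id.prodMap continuous_subtype_val) using 1
    ext ⟨s, t⟩
    have h2 : φ (φ.symm (c s)) = c s := φ.right_inv (hSt (hcS s))
    have h3 := hSt (homothety_mem_starCore (hcS s) t.2)
    simp only [κ, mem_preimage, Function.comp_apply, h2, mem_inter_iff, Prod.map, id]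
    exact ⟨fun h ↦ ⟨h3, h⟩, fun h ↦ h.2⟩
  have hκ1 : ∀ v, Continuous (κ v) := by
    intro v
    have h1 := hκ (fun _ ↦ φ v) (isSmoothCurve_const _) (fun _ ↦ v.2.2)
    have h2 : (⟨φ.symm (φ v), hmem v.2.2⟩ : V) = v := Subtype.ext (φ.left_inv v.2.1)
    simp only [h2] at h1
    exact h1.comp (Continuous.prodMk_right (0 : ℝ))
  -- Curves test continuity on `V`, but not evidently on `V × [0, 1]` with the product topology. So
  -- the homotopy is curried, tested along curves, and uncurried by local compactness of `[0, 1]`.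
  have hκ2 : Continuous fun v ↦ (⟨κ v, hκ1 v⟩ : C(unitInterval, V)) :=
    hcont _ fun c hc hcS ↦ ContinuousMap.continuous_of_continuous_uncurry _ (hκ c hc hcS)
  have hκ3 : Continuous fun z : V × unitInterval ↦ κ z.1 z.2 :=
    ContinuousMap.continuous_uncurry_of_continuous ⟨_, hκ2⟩
  rw [contractible_iff_id_nullhomotopic]
  refine ⟨⟨x, hxV⟩, ⟨ContinuousMap.Homotopy.symm ⟨⟨fun z ↦ κ z.2 z.1, hκ3.comp continuous_swap⟩,
    fun v ↦ ?_, fun v ↦ ?_⟩⟩⟩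
  · exact Subtype.ext (by simpa [κ] using φ.left_inv hi)
  · exact Subtype.ext (by simpa [κ] using φ.left_inv v.2.1)

end ConvAtlas


/-! ### Skeletal plots factor locally through spaces of small dimension -/

/-- The maps that locally factor through a plot of dimension at most `d`. -/
@[reducible]
def locallyFactoring {X : Type*} (d : ℕ) (D : DiffeologicalSpace X) : DiffeologicalSpace X where
  plots n := {p | ∀ x, ∃ k ≤ d, ∃ q : EuclideanSpace ℝ (Fin k) → X, @IsPlot X D k q ∧
    ∃ f : EuclideanSpace ℝ (Fin n) → EuclideanSpace ℝ (Fin k), ContDiffAt ℝ ∞ f x ∧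
      p =ᶠ[𝓝 x] q ∘ f}
  constant_plots y _ := ⟨0, Nat.zero_le _, fun _ ↦ y, D.constant_plots y, fun _ ↦ 0,
    contDiffAt_const, Eventually.of_forall fun _ ↦ rfl⟩
  plot_reparam {_ _ p g} hp hg x := by
    obtain ⟨k, hk, q, hq, f, hf, hpq⟩ := hp (g x)
    exact ⟨k, hk, q, hq, f ∘ g, hf.comp x hg.contDiffAt,
      (hg.continuous.tendsto x).eventually hpq⟩
  locality {_ p} h x := by
    obtain ⟨u, hu, hxu, hp⟩ := h x
    obtain ⟨r, hr, hru⟩ := Metric.isOpen_iff.1 hu x hxu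
    let e := OpenPartialHomeomorph.univBall x r
    have hsrc : e.source = univ := OpenPartialHomeomorph.univBall_source x r
    have htgt : e.target = Metric.ball x r := OpenPartialHomeomorph.univBall_target x hr
    have hx : x ∈ e.target := htgt ▸ Metric.mem_ball_self hr
    have he : ∀ z, e z ∈ u := fun z ↦ hru (htgt ▸ e.map_source (by rw [hsrc]; trivial))
    obtain ⟨k, hk, q, hq, f, hf, hpq⟩ :=
      hp he OpenPartialHomeomorph.contDiff_univBall (e.symm x)
    refine ⟨k, hk, q, hq, f ∘ e.symm, hf.comp x ?_, ?_⟩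
    · exact OpenPartialHomeomorph.contDiffOn_univBall_symm.contDiffAt
        (Metric.ball_mem_nhds x hr)
    · filter_upwards [(e.symm.continuousAt hx).eventually hpq, e.open_target.mem_nhds hx]
        with z hz hzt
      simpa [e.right_inv hzt] using hz

/-- The locally factoring maps form a diffeology containing the generators of the skeleton, hence
all its plots. -/
theorem exists_factor_of_isPlot_skeleton {X : Type*} {d : ℕ} {D : DiffeologicalSpace X} {n : ℕ}
    {p : EuclideanSpace ℝ (Fin n) → X} (hp : @IsPlot X (skeleton d D) n p)
    (x : EuclideanSpace ℝ (Fin n)) :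
    ∃ k ≤ d, ∃ q : EuclideanSpace ℝ (Fin k) → X, @IsPlot X D k q ∧
      ∃ f : EuclideanSpace ℝ (Fin n) → EuclideanSpace ℝ (Fin k), ContDiffAt ℝ ∞ f x ∧
        p =ᶠ[𝓝 x] q ∘ f := by
  have h : skeleton d D ≤ locallyFactoring d D :=
    DiffeologicalSpace.generateFrom_le_iff.2 fun n q hq x ↦
      ⟨n, hq.1, q, hq.2, id, contDiffAt_id, Eventually.of_forall fun _ ↦ rfl⟩
  exact DiffeologicalSpace.le_iff'.1 h n p hp x

theorem ConvAtlas.exists_lipschitzOnWith_of_isPlot {M : Type*} {ι : Type*} {E : ι → Type*}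
    [∀ i, AddCommGroup (E i)] [∀ i, Module ℝ (E i)] [∀ i, TopologicalSpace (E i)]
    (A : ConvAtlas M E) {k : ℕ} {q : EuclideanSpace ℝ (Fin k) → M}
    (hq : @IsPlot M A.diffeology k q) (i : ι) {z : EuclideanSpace ℝ (Fin k)}
    (hz : q z ∈ (A.chart i).source) {G : Type*} [NormedAddCommGroup G] [NormedSpace ℝ G]
    (π : E i →L[ℝ] G) : ∃ K, ∃ N ∈ 𝓝 z, LipschitzOnWith K (fun w ↦ π (A.chart i (q w))) N := by
  obtain ⟨W, -, hW, hzW, -, hs⟩ := hq z trivial i hz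
  refine ConvSmoothOn.exists_lipschitzOnWith (W := W) (fun c hc hcW ↦ ?_) hW hzW
  exact (hs c hc hcW).clm_comp π

/-- A finite-dimensional subspace of a locally convex Hausdorff space splits off. -/
theorem exists_split {F : Type*} [AddCommGroup F] [Module ℝ F] [TopologicalSpace F]
    [IsTopologicalAddGroup F] [ContinuousSMul ℝ F] [LocallyConvexSpace ℝ F] [T2Space F] {n : ℕ}
    (hn : (n : ℕ∞) ≤ Cardinal.toENat (Module.rank ℝ F)) :
    ∃ (s : EuclideanSpace ℝ (Fin n) →L[ℝ] F) (π : F →L[ℝ] EuclideanSpace ℝ (Fin n)),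
      ∀ v, π (s v) = v := by
  have h1 : (n : Cardinal) ≤ Module.rank ℝ F := by simpa using hn
  obtain ⟨b, hb⟩ := Module.le_rank_iff.1 h1
  let s₀ : EuclideanSpace ℝ (Fin n) →ₗ[ℝ] F :=
    (Fintype.linearCombination ℝ b) ∘ₗ (WithLp.linearEquiv 2 ℝ (Fin n → ℝ)).toLinearMap
  have hs₀ : Function.Injective s₀ :=
    (LinearIndependent.fintypeLinearCombination_injective hb).comp
      (WithLp.linearEquiv 2 ℝ (Fin n → ℝ)).injective
  have hsurj := (SeparatingDual.dualMap_surjective_iff (f := s₀)).2 hs₀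
  -- By Hahn–Banach the coordinate functionals on the image of `s₀` extend to continuous functionals
  -- on `F`.
  choose π hπ using fun j : Fin n ↦ hsurj (EuclideanSpace.proj j : _ →L[ℝ] ℝ).toLinearMap
  refine ⟨LinearMap.toContinuousLinearMap s₀,
    (EuclideanSpace.equiv (Fin n) ℝ).symm.toContinuousLinearMap ∘L ContinuousLinearMap.pi π,
    fun v ↦ ?_⟩
  ext j
  simpa using LinearMap.congr_fun (hπ j) v

/-! ### Radial projections -/

section Direction

/-- The radial projection to the unit sphere. -/
noncomputable def direction {E : Type*} [NormedAddCommGroup E] [NormedSpace ℝ E] (v : E) : E :=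
  ‖v‖⁻¹ • v

theorem norm_direction_le {E : Type*} [NormedAddCommGroup E] [NormedSpace ℝ E] (v : E) :
    ‖direction v‖ ≤ 1 := by
  rw [direction, norm_smul, norm_inv, norm_norm]
  exact inv_mul_le_one

theorem direction_smul {E : Type*} [NormedAddCommGroup E] [NormedSpace ℝ E] {t : ℝ} (ht : 0 < t)
    (v : E) : direction (t • v) = direction v := by
  rw [direction, direction, norm_smul, Real.norm_of_nonneg ht.le, smul_smul, mul_inv,
    mul_right_comm, inv_mul_cancel₀ ht.ne', one_mul]

theorem contDiffAt_direction {E : Type*} [NormedAddCommGroup E] [InnerProductSpace ℝ E] {v : E}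
    (hv : v ≠ 0) : ContDiffAt ℝ ∞ (direction (E := E)) v :=
  ((contDiffAt_norm ℝ hv).inv (norm_ne_zero_iff.2 hv)).smul contDiffAt_id

/-- Away from the origin of `ℝᵈ⁺¹`, the radial projection factors locally through `ℝᵈ`. -/
theorem exists_direction_factor {d : ℕ} {x : EuclideanSpace ℝ (Fin (d + 1))} (hx : x ≠ 0) :
    ∃ g : EuclideanSpace ℝ (Fin d) → EuclideanSpace ℝ (Fin (d + 1)), ContDiff ℝ ∞ g ∧
      (∀ w, g w ≠ 0) ∧ ∃ f : EuclideanSpace ℝ (Fin (d + 1)) → EuclideanSpace ℝ (Fin d),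
        ContDiffAt ℝ ∞ f x ∧ ∀ᶠ z in 𝓝 x, direction (g (f z)) = direction z := by
  obtain ⟨j, hj⟩ : ∃ j, x j ≠ 0 := by
    by_contra! h
    exact hx (by ext j; simpa using h j)
  -- The sign `a = ±1` of `x j` selects the hyperplane `z j = a`, onto which points near `x` are
  -- projected along rays from the origin.
  obtain ⟨a, ha, hax⟩ : ∃ a : ℝ, a * a = 1 ∧ 0 < a * x j := by
    rcases lt_or_gt_of_ne hj with h | h
    · exact ⟨-1, by norm_num, by linarith⟩
    · exact ⟨1, by norm_num, by linarith⟩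
  have hcoord : Continuous fun z : EuclideanSpace ℝ (Fin (d + 1)) ↦ a * z j := by fun_prop
  refine ⟨fun w ↦ WithLp.toLp 2 (j.insertNth a w), ?_, fun w hw ↦ ?_,
    fun z ↦ WithLp.toLp 2 fun l ↦ (a * z j)⁻¹ * z (j.succAbove l), ?_, ?_⟩
  · rw [contDiff_euclidean]
    intro l
    induction l using j.succAboveCases with
    | x => simpa using contDiff_const
    | p l => simp only [Fin.insertNth_apply_succAbove]; fun_prop
  · have : a = 0 := by simpa using congrArg (fun v : EuclideanSpace ℝ (Fin (d + 1)) ↦ v j) hw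
    simp [this] at ha
  · rw [contDiffAt_euclidean]
    intro l
    refine ContDiffAt.mul (ContDiffAt.inv (by fun_prop) hax.ne') (by fun_prop)
  · filter_upwards [hcoord.continuousAt.eventually (lt_mem_nhds hax)] with z hz
    rw [← direction_smul (inv_pos.2 hz) z]
    congr 1
    ext l
    induction l using j.succAboveCases with
    | x =>
      simp only [Fin.insertNth_apply_same, PiLp.smul_apply, smul_eq_mul]
      have : z j ≠ 0 := fun h ↦ by simp [h] at hz
      have : a ≠ 0 := fun h ↦ by simp [h] at hz
      field_simp
      linarith
    | p l => simp

end Direction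

/-! ### Failure of smooth local contractibility -/

namespace ConvAtlas

variable {M : Type*} {ι : Type*} {E : ι → Type*} [∀ i, AddCommGroup (E i)]
  [∀ i, Module ℝ (E i)] [∀ i, TopologicalSpace (E i)] (A : ConvAtlas M E)
  [∀ i, IsTopologicalAddGroup (E i)] {d : ℕ}

/-- A small sphere of dimension `d` in a chart, seen as a map on `ℝᵈ⁺¹` constant along rays,
composed with a smooth homotopy for the `d`-skeletal diffeology, factors locally through plots of
dimension at most `d`. -/
theorem exists_factor_homotopy {V U : Set M} {H : V × ℝ → U}
    (hH : @DSmooth (V × ℝ) U (prodDiffeology (subspaceDiffeology (skeleton d A.diffeology) V)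
      inferInstance) (subspaceDiffeology (skeleton d A.diffeology) U) H)
    (i : ι) (v : E i) (s : EuclideanSpace ℝ (Fin (d + 1)) →L[ℝ] E i)
    (hst : ∀ z, v + s (direction z) ∈ (A.chart i).target)
    (hsV : ∀ z, (A.chart i).symm (v + s (direction z)) ∈ V)
    {χ : EuclideanSpace ℝ (Fin (d + 1)) → ℝ} (hχ : ContDiff ℝ ∞ χ)
    {x : EuclideanSpace ℝ (Fin (d + 1))} (hx : x ≠ 0) :
    ∃ k ≤ d, ∃ q : EuclideanSpace ℝ (Fin k) → M, @IsPlot M A.diffeology k q ∧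
      ∃ f : EuclideanSpace ℝ (Fin (d + 1)) → EuclideanSpace ℝ (Fin k), ContDiffAt ℝ ∞ f x ∧
        (fun z ↦ (H (⟨_, hsV z⟩, χ z) : M)) =ᶠ[𝓝 x] q ∘ f := by
  obtain ⟨g, hg, hg0, f₁, hf₁, hgf⟩ := exists_direction_factor hx
  let q₁ : EuclideanSpace ℝ (Fin d) → V := fun w ↦ ⟨_, hsV (g w)⟩
  have hq₁ : @IsPlot V (subspaceDiffeology (skeleton d A.diffeology) V) d q₁ := by
    refine DiffeologicalSpace.isPlot_generatedFrom_of_mem ⟨le_rfl, ?_⟩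
    refine A.isPlot_chart_symm i (g := fun w ↦ v + s (direction (g w))) (fun c hc _ ↦ ?_)
      fun w ↦ hst _
    rw [isSmoothCurve_iff_contDiff] at hc
    have h1 : ContDiff ℝ ∞ fun t ↦ direction (g (c t)) := contDiff_iff_contDiffAt.2 fun t ↦
      ContDiffAt.comp (g := direction) (f := g ∘ c) t (contDiffAt_direction (hg0 (c t)))
        (hg.comp hc).contDiffAt
    exact (isSmoothCurve_const v).add ((isSmoothCurve_iff_contDiff.2 h1).clm_comp s)
  -- Time is a free extra coordinate: `P` is a plot of dimension `d + 1`, yet its image under `H`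
  -- must factor through dimension at most `d`.
  let P : EuclideanSpace ℝ (Fin (d + 1)) → V × ℝ := fun ζ ↦
    (q₁ (WithLp.toLp 2 fun l ↦ ζ l.castSucc), ζ (Fin.last d))
  have hP : @IsPlot (V × ℝ) (prodDiffeology (subspaceDiffeology (skeleton d A.diffeology) V)
      inferInstance) (d + 1) P := by
    refine DiffeologicalSpace.isPlot_inf_iff.2 ⟨?_, ?_⟩
    · refine @isPlot_reparam V (subspaceDiffeology (skeleton d A.diffeology) V) _ _ q₁
        (fun ζ : EuclideanSpace ℝ (Fin (d + 1)) ↦ WithLp.toLp 2 fun l ↦ ζ l.castSucc) hq₁ ?_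
      rw [contDiff_euclidean]
      intro l
      simp only
      fun_prop
    · have : ContDiff ℝ ∞ fun ζ : EuclideanSpace ℝ (Fin (d + 1)) ↦ ζ (Fin.last d) := by fun_prop
      exact this.isPlot
  let Φ : EuclideanSpace ℝ (Fin (d + 1)) → EuclideanSpace ℝ (Fin (d + 1)) := fun z ↦
    WithLp.toLp 2 (Fin.snoc (α := fun _ ↦ ℝ) (f₁ z) (χ z))
  have hΦ : ContDiffAt ℝ ∞ Φ x := by
    rw [contDiffAt_euclidean] at hf₁ ⊢
    intro l
    induction l using Fin.lastCases with
    | last => simpa [Φ] using hχ.contDiffAt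
    | cast l => simpa [Φ] using hf₁ l
  obtain ⟨k, hk, q, hq, f, hf, hqf⟩ := exists_factor_of_isPlot_skeleton (hH _ P hP) (Φ x)
  refine ⟨k, hk, q, hq, f ∘ Φ, hf.comp x hΦ, ?_⟩
  filter_upwards [hΦ.continuousAt.eventually hqf, hgf] with z hz hgz
  rw [Function.comp_apply, Function.comp_apply, ← Function.comp_apply (f := q), ← hz]
  simp [P, Φ, q₁, hgz]

/-- Contractibility is refuted with `U` the domain of the chart, so that the whole homotopy can be
read in that chart and projected by `π`. -/
theorem not_smoothlyLocallyContractible_skeleton [∀ i, ContinuousSMul ℝ (E i)] (hd : 0 < d) (i : ι)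
    (hi : (A.chart i).source.Nonempty) (s : EuclideanSpace ℝ (Fin (d + 1)) →L[ℝ] E i)
    (π : E i →L[ℝ] EuclideanSpace ℝ (Fin (d + 1))) (hπ : ∀ v, π (s v) = v) :
    ¬ SmoothlyLocallyContractible (skeleton d A.diffeology) := by
  intro hcon
  obtain ⟨x₀, hx₀⟩ := hi
  obtain ⟨V, hVU, hV, hxV, y, H, hH, hH0, hH1⟩ :=
    hcon x₀ _ (isOpen_skeleton d (A.isOpen_source i)) hx₀
  let φ := A.chart i
  -- a small ball around `x₀`
  obtain ⟨ρ, hρ, hball⟩ : ∃ ρ : ℝ, 0 < ρ ∧ ∀ v : EuclideanSpace ℝ (Fin (d + 1)), ‖v‖ ≤ 1 →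
      φ x₀ + s (ρ • v) ∈ φ.target ∩ φ.symm ⁻¹' V := by
    have h1 : ConvSmoothOn (fun v ↦ φ x₀ + s v) univ := fun c hc _ ↦
      (isSmoothCurve_const (φ x₀)).add (hc.clm_comp s)
    have h2 := h1.isOpen_inter_preimage isOpen_univ (A.isCInftyOpen_of_isOpen_skeleton hd i hV)
    rw [univ_inter] at h2
    obtain ⟨r, hr, h3⟩ := Metric.isOpen_iff.1 h2 0
      (by simpa [φ] using ⟨φ.map_source hx₀, by simpa [φ, φ.left_inv hx₀] using hxV⟩)
    refine ⟨r / 2, by positivity, fun v hv ↦ h3 ?_⟩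
    rw [mem_ball_zero_iff, norm_smul, Real.norm_of_nonneg (by positivity)]
    nlinarith
  let σ : EuclideanSpace ℝ (Fin (d + 1)) →L[ℝ] E i := s.comp (ρ • ContinuousLinearMap.id ℝ _)
  have hσ : ∀ z, φ x₀ + σ (direction z) ∈ φ.target ∩ φ.symm ⁻¹' V := fun z ↦
    hball _ (norm_direction_le z)
  -- Time is `0` on the unit sphere and `1` for `‖z‖ ≤ 1 / 2`, where the homotopy is constant; this
  -- hides the singularity of `direction` at the origin.
  let χ : EuclideanSpace ℝ (Fin (d + 1)) → ℝ := fun z ↦ Real.smoothTransition (2 - 4 * ‖z‖ ^ 2)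
  have hχ : ContDiff ℝ ∞ χ := Real.smoothTransition.contDiff.comp
    (contDiff_const.sub (contDiff_const.mul (contDiff_norm_sq ℝ)))
  let h : EuclideanSpace ℝ (Fin (d + 1)) → M := fun z ↦ H (⟨_, (hσ z).2⟩, χ z)
  let π' : E i →L[ℝ] EuclideanSpace ℝ (Fin (d + 1)) := ρ⁻¹ • π
  -- Centred at `φ x₀` and rescaled by `ρ⁻¹`, so that `G` is exactly the identity on the unit
  -- sphere.
  let G : EuclideanSpace ℝ (Fin (d + 1)) → EuclideanSpace ℝ (Fin (d + 1)) := fun z ↦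
    π' (φ (h z)) - π' (φ x₀)
  have hfactor : ∀ x, ∃ k ≤ d, ∃ q : EuclideanSpace ℝ (Fin k) → M, @IsPlot M A.diffeology k q ∧
      ∃ f : EuclideanSpace ℝ (Fin (d + 1)) → EuclideanSpace ℝ (Fin k), ContDiffAt ℝ ∞ f x ∧
        h =ᶠ[𝓝 x] q ∘ f := by
    intro x
    by_cases hx : x = 0
    · refine ⟨0, Nat.zero_le _, fun _ ↦ y, A.diffeology.constant_plots _, fun _ ↦ 0,
        contDiffAt_const, ?_⟩
      subst hx
      filter_upwards [Metric.ball_mem_nhds 0 (by norm_num : (0 : ℝ) < 1 / 2)] with z hz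
      have h1 : ‖z‖ < 1 / 2 := by simpa using hz
      have h2 : χ z = 1 := Real.smoothTransition.one_of_one_le (by nlinarith [norm_nonneg z])
      simp [h, h2, hH1]
    · exact A.exists_factor_homotopy hH i (φ x₀) σ (fun z ↦ (hσ z).1) (fun z ↦ (hσ z).2) hχ hx
  have hfactor' : ∀ x, ∃ k ≤ d, ∃ (Q : EuclideanSpace ℝ (Fin k) → EuclideanSpace ℝ (Fin (d + 1)))
      (f : EuclideanSpace ℝ (Fin (d + 1)) → EuclideanSpace ℝ (Fin k)), ContDiffAt ℝ ∞ f x ∧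
        G =ᶠ[𝓝 x] Q ∘ f ∧ ∃ K, ∃ N ∈ 𝓝 (f x), LipschitzOnWith K Q N := by
    intro x
    obtain ⟨k, hk, q, hq, f, hf, hqf⟩ := hfactor x
    have hqx : q (f x) ∈ φ.source := by
      rw [← Function.comp_apply (f := q), ← hqf.self_of_nhds]
      exact (H _).2
    obtain ⟨K, N, hN, hK⟩ := A.exists_lipschitzOnWith_of_isPlot hq i hqx π'
    refine ⟨k, hk, fun w ↦ π' (φ (q w)) - π' (φ x₀), f, hf, ?_, K, N, hN, ?_⟩
    · filter_upwards [hqf] with z hz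
      simp only [G, hz, Function.comp_apply]
    · refine LipschitzOnWith.of_dist_le_mul fun a ha b hb ↦ ?_
      rw [dist_sub_right]
      exact hK.dist_le_mul a ha b hb
  have hGlip : LocallyLipschitz G := by
    intro x
    obtain ⟨k, -, Q, f, hf, hG, K, N, hN, hQ⟩ := hfactor' x
    obtain ⟨K', N', hN', hf'⟩ := (hf.of_le (by exact_mod_cast le_top :
      (1 : WithTop ℕ∞) ≤ ∞)).exists_lipschitzOnWith
    refine ⟨K * K', {z | G z = (Q ∘ f) z} ∩ (N' ∩ f ⁻¹' N), inter_mem hG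
      (inter_mem hN' (hf.continuousAt hN)), ?_⟩
    have hQf : LipschitzOnWith (K * K') (Q ∘ f) (N' ∩ f ⁻¹' N) :=
      hQ.comp (hf'.mono inter_subset_left) fun z hz ↦ hz.2
    intro a ha b hb
    rw [show G a = _ from ha.1, show G b = _ from hb.1]
    exact hQf ha.2 hb.2
  have hGid : ∀ x, ‖x‖ = 1 → G x = x := by
    intro x hx
    have h1 : χ x = 0 := Real.smoothTransition.zero_of_nonpos (by rw [hx]; norm_num)
    have h2 : direction x = x := by simp [direction, hx]
    have h3 : h x = φ.symm (φ x₀ + σ (direction x)) := by simp [h, h1, hH0, φ]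
    have h4 : φ (h x) = φ x₀ + σ x := by rw [h3, φ.right_inv (hσ x).1, h2]
    simp only [G, h4, map_add, add_sub_cancel_left]
    simp [π', σ, hπ, smul_smul, hρ.ne']
  obtain ⟨x, hGx, hdet⟩ := exists_det_fderiv_ne_zero hGlip hGid
  obtain ⟨k, hk, Q, f, hf, hG, K, N, hN, hQ⟩ := hfactor' x
  exact hdet (det_fderiv_eq_zero_of_factor (by simp; omega)
    (hf.differentiableAt (by simp)) hN hQ hG hGx)

end ConvAtlas

end Skeletal

open Skeletal
theorem corollary1p5 {M : Type*} {ι : Type*} (E : ι → Type*) [∀ i, AddCommGroup (E i)]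
    [∀ i, Module ℝ (E i)] [∀ i, TopologicalSpace (E i)] [∀ i, ConvenientSpace (E i)]
    (A : ConvAtlas M E) (hsep : @ArcSeparated M A.diffeology.dTopology)
    (d : ℕ) (hd : 0 < d) (hdim : (d : ℕ∞) < A.dim) :
    ¬ SmoothlyLocallyContractible (skeleton d A.diffeology) ∧
      @HasContractibleOpenBasis M (skeleton d A.diffeology).dTopology := by
  have : ∀ i, IsTopologicalAddGroup (E i) := fun i ↦ ConvenientSpace.isTopologicalAddGroup
  have : ∀ i, ContinuousSMul ℝ (E i) := fun i ↦ ConvenientSpace.continuousSMul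
  have : ∀ i, LocallyConvexSpace ℝ (E i) := fun i ↦ ConvenientSpace.locallyConvex
  have : ∀ i, T2Space (E i) := fun i ↦ ConvenientSpace.t2
  refine ⟨?_, A.hasContractibleOpenBasis_skeleton hd⟩
  obtain ⟨i, hi⟩ := lt_iSup_iff.1 hdim
  obtain ⟨hne, hi⟩ := lt_iSup_iff.1 hi
  obtain ⟨s, π, hπ⟩ := exists_split (n := d + 1) (by
    rw [Nat.cast_add, Nat.cast_one]
    exact Order.add_one_le_of_lt hi)
  exact A.not_smoothlyLocallyContractible_skeleton hd i hne s π hπ
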